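/- Let $r\in\mathbb N$, $\rho>0$, $\omega=(\omega_1,\dots,\omega_r)\in\mathbb R^r$, and let $a:\mathbb R\to\mathbb R$ be analytic quasi-periodic on $D_\rho=\{\theta\in\mathbb C^r: |\operatorname{Im}\theta_j|\le\rho,\ j=1,\dots,r\}$ with frequencies $\omega$; that is, $a(t)=F(\omega_1t,\dots,\omega_rt)$ for all $t\in\mathbb{R}$, where $F$ is analytic on $D_\rho$ (in a neighbourhood of each of its points) and $2\pi$-periodic in each argument. Assume that the average $\bar a=\lim_{T\to\infty}\frac1{2T}\int_{-T}^{T}a(t)\,dt$ is positive, and that for some constants $\alpha>0$ and $\tau>r-1$ $$|\langle k,\omega\rangle|\ \ge\ \frac{\alpha}{|k|^{\tau}}\qquad\text{for all } k\in\mathbb Z^r\setminus\{0\},\qquad |k|=|k_1|+\dots+|k_r|.$$ Then the equilibrium $x=0$ of Hill's equation $\ddot x+\varepsilon a(t)x=0$ is stable in the sense of Lyapunov for most sufficiently small $\varepsilon>0$. Precisely, let $S$ be the set of all $\varepsilon>0$ such that for every $t_0\in\mathbb R$ and every $\eta>0$ there is $\delta>0$ for which every solution with $\max(|x(t_0)|,|\dot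 x(t_0)|)<\delta$ satisfies $\max(|x(t)|,|\dot x(t)|)<\eta$ for all $t\ge t_0$. Then, with $\operatorname{meas}$ denoting Lebesgue (outer) measure, $$\lim_{\varepsilon_0\to0^+}\frac{\operatorname{meas}\big((0,\varepsilon_0)\setminus S\big)}{\varepsilon_0}=0 .$$ -/

import Mathlib

open Filter Topology MeasureTheory

noncomputable section

/-- The closed complex strip `D_ρ = {θ ∈ ℂ^r : |Im θ_j| ≤ ρ for all j}`. -/
def complexStrip (r : ℕ) (ρ : ℝ) : Set (Fin r → ℂ) :=
  {θ | ∀ j, |(θ j).im| ≤ ρ}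

/-- The real function `a` is analytic quasi-periodic on `D_ρ` with the vector `ω` of basic
frequencies: `a(t) = F(ω₁ t, …, ω_r t)` for some `F` that is `2π`-periodic in each argument and
analytic on `D_ρ` (that is, in a neighbourhood of each point of `D_ρ`). -/
def IsAnalyticQuasiPeriodic {r : ℕ} (ω : Fin r → ℝ) (ρ : ℝ) (a : ℝ → ℝ) : Prop :=
  ∃ F : (Fin r → ℂ) → ℂ,
    AnalyticOnNhd ℂ F (complexStrip r ρ) ∧
    (∀ θ ∈ complexStrip r ρ, ∀ j : Fin r,
      F (θ + Pi.single j ((2 * Real.pi : ℝ) : ℂ)) = F θ) ∧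
    ∀ t : ℝ, (a t : ℂ) = F (fun j => ((ω j * t : ℝ) : ℂ))

/-- The average `lim_{T → ∞} (1 / 2T) ∫_{-T}^{T} a(t) dt` of `a` exists and equals `m`. -/
def HasAverage (a : ℝ → ℝ) (m : ℝ) : Prop :=
  Tendsto (fun T : ℝ => (1 / (2 * T)) * ∫ t in (-T)..T, a t) atTop (𝓝 m)

/-- The Diophantine condition `|⟨k, ω⟩| ≥ α / |k|^τ` for all `k ∈ ℤ^r \ {0}`, with
`|k| = |k₁| + ⋯ + |k_r|`. -/
def IsDiophantine {r : ℕ} (ω : Fin r → ℝ) (α τ : ℝ) : Prop :=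
  ∀ k : Fin r → ℤ, k ≠ 0 →
    α / (∑ j, |(k j : ℝ)|) ^ τ ≤ |∑ j, (k j : ℝ) * ω j|

/-- Lyapunov stability of the equilibrium `p` of `ż = f(t, z)`: for every initial time `t₀` and
every `η > 0` there is `δ > 0` such that each solution that is `δ`-close to `p` at time `t₀` stays
`η`-close to `p` for all later times. Solutions on all intervals `[t₀, T]` are considered, so
that solutions which blow up in finite time are not ignored. -/
def IsLyapunovStable {E : Type*} [NormedAddCommGroup E] [NormedSpace ℝ E]
    (f : ℝ → E → E) (p : E) : Prop :=
  (∀ t, f t p = 0) ∧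
  ∀ t₀ : ℝ, ∀ η > 0, ∃ δ > 0, ∀ (T : ℝ) (z : ℝ → E),
    IsIntegralCurveOn z f (Set.Icc t₀ T) → ‖z t₀ - p‖ < δ →
      ∀ t ∈ Set.Icc t₀ T, ‖z t - p‖ < η

/-- The first order system `ẋ = y`, `ẏ = -q(t) x` equivalent to Hill's equation
`ẍ + q(t) x = 0`, as a time-dependent vector field on the phase plane. -/
def hillField (q : ℝ → ℝ) (t : ℝ) (z : ℝ × ℝ) : ℝ × ℝ :=
  (z.2, -(q t * z.1))

/-- `P ε` holds for most sufficiently small `ε > 0`: the relative Lebesgue (outer) measure in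
`(0, ε₀)` of the set of exceptional `ε` tends to `0` as `ε₀ → 0⁺`. -/
def ForMostSmallPos (P : ℝ → Prop) : Prop :=
  Tendsto (fun ε₀ : ℝ => volume (Set.Ioo 0 ε₀ \ {ε | P ε}) / ENNReal.ofReal ε₀)
    (𝓝[>] 0) (𝓝 0)

end

/-!
In the complex coordinate `u = X + iW`, a traceless real planar linear system is
`u' = i p u + q ū` with `p` real. If `q = 0` then `|u|` is constant; so the zero solution is stable
as soon as `q` can be transformed away by bounded coordinate changes. This is done for most `ε` by a
KAM iteration, with `Λ ∼ √(ε ā)` as the small parameter.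

*Averaging.* The explicit coordinates of `isLyapunovStable_of_growthBound` turn Hill's equation
into such a system with `p = -Λ + O(Λ³)` and `q = O(Λ²)`; they only use a primitive of the mean-free
part of `a`, which is again quasi-periodic by the Diophantine condition (`exists_primitive`).

*One step.* For a constant `p = Λℓ` and `q = ΛQ`, let `h` be the quasi-periodic solution of
`h' = 2iΛℓ h + ΛQ`; its small divisors are `⟨k, ω⟩ - 2Λℓ`. The transformation
`w = (u - h ū) / √(1 - |h|²)` preserves the form of the system. It leaves an off-diagonal term that
is cubic in `(h, Q)` and an oscillating diagonal term that is quadratic, which is then removed by a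
rotation `e^{iφ}` with real `φ` (`exists_step`). The gain is so strong that the off-diagonal terms
decay faster than the losses from the small divisors grow, and the product of all transformations
stays bounded (`exists_iteration`). No limit of the transformations is needed: after `n` steps the
growth rate is at most the size of the `n`-th off-diagonal term, which tends to zero.

*Function spaces.* Quasi-periodic functions depending on a parameter `x` are handled through the
predicate `QPBound`: an expansion in oscillations `e^{i⟨k, ω⟩t}`, absolutely summable with weight
`e^{s|k|}`, with coefficients that are bounded and Lipschitz in `x` on the set of remaining
parameters. It is stable under sums, products, exponentials and geometric series. That an analytic
quasi-periodic `a` has such an expansion is `exists_qpBound`, by a shift of contours.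

*Measure.* On `ε = e x`, `1 ≤ x ≤ 2`, the frequency `ℓ` stays Lipschitz close to `-√x`, so every
resonance `k` removes an `x`-set of diameter `O(2⁻ⁿ (1 + |k|)⁻ᵀ)` in the `n`-th step. As `|2Λℓ|` is
at most `4Λ`, only the `k` with `|⟨k, ω⟩| < 5Λ` matter, and their total contribution tends to zero
with `Λ` (`tendsto_smallDivisorSum`), because `⟨k, ω⟩ ≠ 0` for `k ≠ 0`.
-/

namespace QuasiPeriodic

/-! ### Coefficients depending on a parameter -/

/-- `LipBound E m c` says that `m` bounds the sum of the supremum and of the Lipschitz constant of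
`c` on `E`, in the form `|c x| + |c x - c y| / |x - y| ≤ m` cleared of its denominator. This form
makes the bound submultiplicative. -/
def LipBound (E : Set ℝ) (m : ℝ) (c : ℝ → ℂ) : Prop :=
  0 ≤ m ∧ (∀ x ∈ E, ‖c x‖ ≤ m) ∧
    ∀ x ∈ E, ∀ y ∈ E, ‖c x‖ * |x - y| + ‖c x - c y‖ ≤ m * |x - y|

namespace LipBound

variable {E E' : Set ℝ} {m m' : ℝ} {c d : ℝ → ℂ}

lemma mono (h : LipBound E m c) (hE : E' ⊆ E) (hm : m ≤ m') : LipBound E' m' c :=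
  ⟨h.1.trans hm, fun x hx => (h.2.1 x (hE hx)).trans hm, fun x hx y hy =>
    (h.2.2 x (hE hx) y (hE hy)).trans (mul_le_mul_of_nonneg_right hm (abs_nonneg _))⟩

lemma congr (h : LipBound E m c) (hcd : ∀ x ∈ E, d x = c x) : LipBound E m d := by
  refine ⟨h.1, fun x hx => ?_, fun x hx y hy => ?_⟩
  · rw [hcd x hx]; exact h.2.1 x hx
  · rw [hcd x hx, hcd y hy]; exact h.2.2 x hx y hy

lemma of_le {S l : ℝ} (hS : 0 ≤ S) (hl : 0 ≤ l) (h1 : ∀ x ∈ E, ‖c x‖ ≤ S)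
    (h2 : ∀ x ∈ E, ∀ y ∈ E, ‖c x - c y‖ ≤ l * |x - y|) : LipBound E (S + l) c := by
  refine ⟨by positivity, fun x hx => by linarith [h1 x hx], fun x hx y hy => ?_⟩
  have := mul_le_mul_of_nonneg_right (h1 x hx) (abs_nonneg (x - y))
  linarith [h2 x hx y hy]

lemma const (z : ℂ) : LipBound E ‖z‖ (fun _ => z) := by
  have := of_le (E := E) (c := fun _ => z) (norm_nonneg z) le_rfl (fun _ _ => le_rfl)
    (fun x _ y _ => by simp)
  simpa using this

lemma add (hc : LipBound E m c) (hd : LipBound E m' d) :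
    LipBound E (m + m') (fun x => c x + d x) := by
  refine ⟨add_nonneg hc.1 hd.1, fun x hx => ?_, fun x hx y hy => ?_⟩
  · exact (norm_add_le _ _).trans (add_le_add (hc.2.1 x hx) (hd.2.1 x hx))
  · have h1 := hc.2.2 x hx y hy
    have h2 := hd.2.2 x hx y hy
    have h3 := mul_le_mul_of_nonneg_right (norm_add_le (c x) (d x)) (abs_nonneg (x - y))
    have h4 : ‖c x + d x - (c y + d y)‖ ≤ ‖c x - c y‖ + ‖d x - d y‖ := by
      rw [add_sub_add_comm]; exact norm_add_le _ _
    nlinarith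

lemma mul (hc : LipBound E m c) (hd : LipBound E m' d) :
    LipBound E (m * m') (fun x => c x * d x) := by
  refine ⟨mul_nonneg hc.1 hd.1, fun x hx => ?_, fun x hx y hy => ?_⟩
  · rw [norm_mul]; exact mul_le_mul (hc.2.1 x hx) (hd.2.1 x hx) (norm_nonneg _) hc.1
  · have h1 := hc.2.2 x hx y hy
    have h2 := hd.2.2 x hx y hy
    have h3 := hd.2.1 y hy
    have h4 : ‖c x * d x - c y * d y‖ ≤ ‖c x‖ * ‖d x - d y‖ + ‖c x - c y‖ * ‖d y‖ := by
      rw [← norm_mul, ← norm_mul]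
      refine le_trans (le_of_eq ?_) (norm_add_le _ _)
      congr 1; ring
    rw [norm_mul]
    have h5 := mul_le_mul_of_nonneg_left h2 (norm_nonneg (c x))
    have h6 := mul_le_mul_of_nonneg_left h3 (norm_nonneg (c x - c y))
    have h7 := mul_le_mul_of_nonneg_right h1 hd.1
    nlinarith

lemma conj (hc : LipBound E m c) : LipBound E m (fun x => (starRingEnd ℂ) (c x)) := by
  refine ⟨hc.1, fun x hx => ?_, fun x hx y hy => ?_⟩
  · rw [RCLike.norm_conj]; exact hc.2.1 x hx
  · rw [← map_sub, RCLike.norm_conj, RCLike.norm_conj]; exact hc.2.2 x hx y hy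

lemma ofReal_re (hc : LipBound E m c) : LipBound E m (fun x => (((c x).re : ℝ) : ℂ)) := by
  refine ⟨hc.1, fun x hx => ?_, fun x hx y hy => ?_⟩
  · rw [Complex.norm_real]; exact (Complex.abs_re_le_norm _).trans (hc.2.1 x hx)
  · refine le_trans ?_ (hc.2.2 x hx y hy)
    rw [← Complex.ofReal_sub, Complex.norm_real, Complex.norm_real, ← Complex.sub_re]
    exact add_le_add (mul_le_mul_of_nonneg_right (Complex.abs_re_le_norm _) (abs_nonneg _))
      (Complex.abs_re_le_norm _)

lemma tsum {ι : Type*} {m : ι → ℝ} {c : ι → ℝ → ℂ} (h : ∀ i, LipBound E (m i) (c i))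
    (hm : Summable m) : LipBound E (∑' i, m i) (fun x => ∑' i, c i x) := by
  have hs : ∀ x ∈ E, Summable fun i => ‖c i x‖ := fun x hx =>
    Summable.of_nonneg_of_le (fun _ => norm_nonneg _) (fun i => (h i).2.1 x hx) hm
  refine ⟨tsum_nonneg fun i => (h i).1, fun x hx => ?_, fun x hx y hy => ?_⟩
  · exact (norm_tsum_le_tsum_norm (hs x hx)).trans 
      ((hs x hx).tsum_le_tsum (fun i => (h i).2.1 x hx) hm)
  · have hd : Summable fun i => ‖c i x - c i y‖ :=
      Summable.of_nonneg_of_le (fun _ => norm_nonneg _) (fun i => norm_sub_le _ _)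
        ((hs x hx).add (hs y hy))
    have h1 := norm_tsum_le_tsum_norm (hs x hx)
    have h2 := norm_tsum_le_tsum_norm hd
    rw [(hs x hx).of_norm.tsum_sub (hs y hy).of_norm] at h2
    have h3 := mul_le_mul_of_nonneg_right h1 (abs_nonneg (x - y))
    have h4 : ∑' i, (‖c i x‖ * |x - y| + ‖c i x - c i y‖) ≤ ∑' i, m i * |x - y| :=
      (((hs x hx).mul_right _).add hd).tsum_le_tsum (fun i => (h i).2.2 x hx y hy)
        (hm.mul_right _)
    rw [((hs x hx).mul_right _).tsum_add hd, tsum_mul_right, tsum_mul_right] at h4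
    linarith

/-- Inversion costs a square of the lower bound, because the Lipschitz constant of `1 / c` is
that of `c` divided by the square of the lower bound. -/
lemma inv {d l : ℝ} (hd : 0 < d) (hl : 0 ≤ l) (h1 : ∀ x ∈ E, d ≤ ‖c x‖)
    (h2 : ∀ x ∈ E, ∀ y ∈ E, ‖c x - c y‖ ≤ l * |x - y|) :
    LipBound E (1 / d + l / d ^ 2) (fun x => (c x)⁻¹) := by
  have hb : ∀ x ∈ E, ‖(c x)⁻¹‖ ≤ 1 / d := fun x hx => by
    rw [norm_inv, ← one_div]; exact one_div_le_one_div_of_le hd (h1 x hx)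
  refine of_le (by positivity) (by positivity) hb fun x hx y hy => ?_
  have hx0 : c x ≠ 0 := norm_pos_iff.1 (hd.trans_le (h1 x hx))
  have hy0 : c y ≠ 0 := norm_pos_iff.1 (hd.trans_le (h1 y hy))
  have e : (c x)⁻¹ - (c y)⁻¹ = (c x)⁻¹ * (c y)⁻¹ * (c y - c x) := by
    field_simp
  rw [e, norm_mul, norm_mul, norm_sub_rev]
  calc ‖(c x)⁻¹‖ * ‖(c y)⁻¹‖ * ‖c x - c y‖ ≤ (1 / d) * (1 / d) * (l * |x - y|) := by
        gcongr
        · exact hb x hx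
        · exact hb y hy
        · exact h2 x hx y hy
    _ = l / d ^ 2 * |x - y| := by field_simp

end LipBound

/-! ### Quasi-periodic functions with weighted absolutely summable expansions -/

/-- The frequency `⟨k, ω⟩`. -/
noncomputable def freq {r : ℕ} (ω : Fin r → ℝ) (k : Fin r → ℤ) : ℝ := ∑ j, (k j : ℝ) * ω j

/-- The order `|k| = |k₁| + ⋯ + |k_r|`. -/
noncomputable def order {r : ℕ} (k : Fin r → ℤ) : ℝ := ∑ j, |(k j : ℝ)|

section freq
variable {r : ℕ} (ω : Fin r → ℝ) (k l : Fin r → ℤ)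

lemma freq_add : freq ω (k + l) = freq ω k + freq ω l := by
  simp [freq, add_mul, Finset.sum_add_distrib]

lemma freq_neg : freq ω (-k) = -freq ω k := by simp [freq]

lemma freq_zero : freq ω 0 = 0 := by simp [freq]

lemma order_add_le : order (k + l) ≤ order k + order l := by
  rw [order, order, order, ← Finset.sum_add_distrib]
  exact Finset.sum_le_sum fun j _ => by push_cast [Pi.add_apply]; exact abs_add_le _ _

lemma order_neg : order (-k) = order k := by simp [order]

lemma order_zero : order (0 : Fin r → ℤ) = 0 := by simp [order]

lemma order_nonneg : 0 ≤ order k := Finset.sum_nonneg fun _ _ => abs_nonneg _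

end freq

/-- The oscillation `e^{i⟨k, ω⟩t}`. -/
noncomputable def wave {r : ℕ} (ω : Fin r → ℝ) (k : Fin r → ℤ) (t : ℝ) : ℂ :=
  Complex.exp (((freq ω k * t : ℝ) : ℂ) * Complex.I)

section wave
variable {r : ℕ} (ω : Fin r → ℝ) (k l : Fin r → ℤ) (t : ℝ)

lemma norm_wave : ‖wave ω k t‖ = 1 := Complex.norm_exp_ofReal_mul_I _

lemma wave_add : wave ω (k + l) t = wave ω k t * wave ω l t := by
  rw [wave, wave, wave, ← Complex.exp_add, freq_add]; push_cast; ring_nf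

lemma wave_neg : wave ω (-k) t = (starRingEnd ℂ) (wave ω k t) := by
  rw [wave, wave, ← Complex.exp_conj, freq_neg]; simp

lemma wave_zero : wave ω 0 t = 1 := by simp [wave, freq_zero]

lemma hasDerivAt_wave : HasDerivAt (wave ω k) (freq ω k * Complex.I * wave ω k t) t := by
  have h1 : HasDerivAt (fun t : ℝ => ((freq ω k * t : ℝ) : ℂ) * Complex.I)
      ((freq ω k : ℂ) * Complex.I) t := by
    have := (((hasDerivAt_id t).const_mul (freq ω k)).ofReal_comp).mul_const Complex.I
    simpa using this
  have := h1.cexp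
  rw [mul_comm] at this
  exact this

end wave

/-- `QPBound ω E s M f` says that the family `f x`, `x ∈ E`, of functions of time is given by
series `f x t = ∑ᵢ cᵢ(x) e^{i⟨kᵢ, ω⟩t}` with `∑ᵢ mᵢ e^{s|kᵢ|} ≤ M`, where `mᵢ` bounds `cᵢ` together
with its Lipschitz constant. The index set is arbitrary and the `kᵢ` may repeat: a product of two
such series is then indexed by pairs, and no convolution is needed. -/
def QPBound {r : ℕ} (ω : Fin r → ℝ) (E : Set ℝ) (s M : ℝ) (f : ℝ → ℝ → ℂ) : Prop :=
  ∃ (ι : Type) (k : ι → Fin r → ℤ) (c : ι → ℝ → ℂ) (m : ι → ℝ),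
    (∀ i, LipBound E (m i) (c i)) ∧
    (Summable fun i => m i * Real.exp (s * order (k i))) ∧
    (∑' i, m i * Real.exp (s * order (k i))) ≤ M ∧
    ∀ x ∈ E, ∀ t, HasSum (fun i => c i x * wave ω (k i) t) (f x t)

namespace QPBound

variable {r : ℕ} {ω : Fin r → ℝ} {E E' : Set ℝ} {s s' M M' : ℝ} {f g : ℝ → ℝ → ℂ}

lemma nonneg (h : QPBound ω E s M f) : 0 ≤ M := by
  obtain ⟨ι, k, c, m, hc, hs, hM, -⟩ := h
  exact (tsum_nonneg fun i => mul_nonneg (hc i).1 (Real.exp_nonneg _)).trans hM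

lemma mono (h : QPBound ω E s M f) (hE : E' ⊆ E) (hs : s' ≤ s) (hM : M ≤ M') :
    QPBound ω E' s' M' f := by
  obtain ⟨ι, k, c, m, hc, hsum, hle, hf⟩ := h
  have hcmp : ∀ i, m i * Real.exp (s' * order (k i)) ≤ m i * Real.exp (s * order (k i)) :=
    fun i => mul_le_mul_of_nonneg_left (Real.exp_le_exp.2
      (mul_le_mul_of_nonneg_right hs (order_nonneg _))) (hc i).1
  have hsum' := Summable.of_nonneg_of_le
    (fun i => mul_nonneg (hc i).1 (Real.exp_nonneg _)) hcmp hsum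
  exact ⟨ι, k, c, m, fun i => (hc i).mono hE le_rfl, hsum',
    (hsum'.tsum_le_tsum hcmp hsum).trans (hle.trans hM), fun x hx t => hf x (hE hx) t⟩

lemma congr (h : QPBound ω E s M f) (hfg : ∀ x ∈ E, ∀ t, g x t = f x t) : QPBound ω E s M g := by
  obtain ⟨ι, k, c, m, hc, hsum, hle, hf⟩ := h
  exact ⟨ι, k, c, m, hc, hsum, hle, fun x hx t => by rw [hfg x hx t]; exact hf x hx t⟩

lemma le_weight (hs : 0 ≤ s) {m : ℝ} (hm : 0 ≤ m) (k : Fin r → ℤ) :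
    m ≤ m * Real.exp (s * order k) :=
  le_mul_of_one_le_right hm (Real.one_le_exp (mul_nonneg hs (order_nonneg k)))

lemma norm_le (h : QPBound ω E s M f) (hs : 0 ≤ s) {x : ℝ} (hx : x ∈ E) (t : ℝ) :
    ‖f x t‖ ≤ M := by
  obtain ⟨ι, k, c, m, hc, hsum, hle, hf⟩ := h
  have hcmp : ∀ i, ‖c i x * wave ω (k i) t‖ ≤ m i * Real.exp (s * order (k i)) := fun i => by
    rw [norm_mul, norm_wave, mul_one]
    exact ((hc i).2.1 x hx).trans (le_weight hs (hc i).1 _)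
  have hsn := Summable.of_nonneg_of_le (fun _ => norm_nonneg _) hcmp hsum
  rw [← (hf x hx t).tsum_eq]
  exact ((norm_tsum_le_tsum_norm hsn).trans (hsn.tsum_le_tsum hcmp hsum)).trans hle

lemma of_lipBound {c : ℝ → ℂ} (h : LipBound E M c) : QPBound ω E s M (fun x _ => c x) := by
  refine ⟨Unit, fun _ => 0, fun _ => c, fun _ => M, fun _ => h, (hasSum_fintype _).summable, ?_,
    fun x _ t => ?_⟩
  · simp [order_zero]
  · simp [wave_zero]

lemma const (z : ℂ) : QPBound ω E s ‖z‖ (fun _ _ => z) := of_lipBound (LipBound.const z)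

lemma hasSum {κ : Type} {M : κ → ℝ} {f : κ → ℝ → ℝ → ℂ} (h : ∀ n, QPBound ω E s (M n) (f n))
    (hs : 0 ≤ s) {S : ℝ} (hM : HasSum M S) {g : ℝ → ℝ → ℂ}
    (hg : ∀ x ∈ E, ∀ t, HasSum (fun n => f n x t) (g x t)) : QPBound ω E s S g := by
  choose ι k c m hc hsum hle hf using h
  have hpos : ∀ p : Σ n, ι n, 0 ≤ m p.1 p.2 * Real.exp (s * order (k p.1 p.2)) := fun p =>
    mul_nonneg (hc p.1 p.2).1 (Real.exp_nonneg _)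
  have hsig : Summable fun p : Σ n, ι n => m p.1 p.2 * Real.exp (s * order (k p.1 p.2)) := by
    rw [summable_sigma_of_nonneg hpos]
    exact ⟨hsum, Summable.of_nonneg_of_le
      (fun n => tsum_nonneg fun i => hpos ⟨n, i⟩) hle hM.summable⟩
  refine ⟨Σ n, ι n, fun p => k p.1 p.2, fun p => c p.1 p.2, fun p => m p.1 p.2,
    fun p => hc p.1 p.2, hsig, ?_, fun x hx t => ?_⟩
  · rw [hsig.tsum_sigma, ← hM.tsum_eq]
    exact hsig.sigma.tsum_le_tsum hle hM.summable
  · have hs1 : Summable fun p : Σ n, ι n => c p.1 p.2 x * wave ω (k p.1 p.2) t := by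
      refine Summable.of_norm (Summable.of_nonneg_of_le (fun _ => norm_nonneg _) (fun p => ?_) hsig)
      rw [norm_mul, norm_wave, mul_one]
      exact ((hc p.1 p.2).2.1 x hx).trans (le_weight hs (hc p.1 p.2).1 _)
    have := hs1.hasSum
    rw [hs1.tsum_sigma] at this
    convert this using 1
    rw [← (hg x hx t).tsum_eq]
    exact tsum_congr fun n => ((hf n x hx t).tsum_eq).symm

lemma add (hf : QPBound ω E s M f) (hg : QPBound ω E s M' g) (hs : 0 ≤ s) :
    QPBound ω E s (M + M') (fun x t => f x t + g x t) := by
  have h : ∀ b : Bool, QPBound ω E s (bif b then M else M') (bif b then f else g) := by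
    intro b; cases b <;> simpa
  refine hasSum h hs ?_ fun x hx t => ?_
  · simpa using hasSum_fintype fun b : Bool => bif b then M else M'
  · have := hasSum_fintype fun b : Bool => (bif b then f else g) x t
    simpa using this

lemma mul (hf : QPBound ω E s M f) (hg : QPBound ω E s M' g) (hs : 0 ≤ s) :
    QPBound ω E s (M * M') (fun x t => f x t * g x t) := by
  have hM := hf.nonneg
  obtain ⟨ι, k, c, m, hc, hsum, hle, hf⟩ := hf
  obtain ⟨ι', k', c', m', hc', hsum', hle', hg⟩ := hg
  have hp := hsum.mul_of_nonneg hsum' (fun i => mul_nonneg (hc i).1 (Real.exp_nonneg _))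
    (fun i => mul_nonneg (hc' i).1 (Real.exp_nonneg _))
  have hcmp : ∀ p : ι × ι', m p.1 * m' p.2 * Real.exp (s * order (k p.1 + k' p.2)) ≤
      m p.1 * Real.exp (s * order (k p.1)) * (m' p.2 * Real.exp (s * order (k' p.2))) := by
    intro p
    calc _ ≤ m p.1 * m' p.2 * Real.exp (s * order (k p.1) + s * order (k' p.2)) := by
          refine mul_le_mul_of_nonneg_left (Real.exp_le_exp.2 ?_)
            (mul_nonneg (hc p.1).1 (hc' p.2).1)
          rw [← mul_add]
          exact mul_le_mul_of_nonneg_left (order_add_le _ _) hs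
      _ = _ := by rw [Real.exp_add]; ring
  have hsm := Summable.of_nonneg_of_le
    (fun p : ι × ι' => mul_nonneg (mul_nonneg (hc p.1).1 (hc' p.2).1) (Real.exp_nonneg _)) hcmp hp
  refine ⟨ι × ι', fun p => k p.1 + k' p.2, fun p x => c p.1 x * c' p.2 x,
    fun p => m p.1 * m' p.2, fun p => (hc p.1).mul (hc' p.2), hsm, ?_, fun x hx t => ?_⟩
  · have hprod := hsum.tsum_mul_tsum hsum' hp
    refine (hsm.tsum_le_tsum hcmp hp).trans (hprod.symm.le.trans ?_)
    exact mul_le_mul hle hle' (tsum_nonneg fun i => mul_nonneg (hc' i).1 (Real.exp_nonneg _)) hM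
  · have hn : Summable fun i => ‖c i x * wave ω (k i) t‖ :=
      Summable.of_nonneg_of_le (fun _ => norm_nonneg _) (fun i => by
        rw [norm_mul, norm_wave, mul_one]
        exact ((hc i).2.1 x hx).trans (le_weight hs (hc i).1 _)) hsum
    have hn' : Summable fun i => ‖c' i x * wave ω (k' i) t‖ :=
      Summable.of_nonneg_of_le (fun _ => norm_nonneg _) (fun i => by
        rw [norm_mul, norm_wave, mul_one]
        exact ((hc' i).2.1 x hx).trans (le_weight hs (hc' i).1 _)) hsum'
    have hnn : Summable fun p : ι × ι' =>
        (c p.1 x * wave ω (k p.1) t) * (c' p.2 x * wave ω (k' p.2) t) :=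
      summable_mul_of_summable_norm (f := fun i => c i x * wave ω (k i) t)
        (g := fun i => c' i x * wave ω (k' i) t) hn hn'
    have := (hf x hx t).mul (hg x hx t) hnn
    have e : (fun p : ι × ι' => c p.1 x * c' p.2 x * wave ω (k p.1 + k' p.2) t) =
        fun p => (c p.1 x * wave ω (k p.1) t) * (c' p.2 x * wave ω (k' p.2) t) := by
      funext p; rw [wave_add]; ring
    rw [e]; exact this

lemma conj (hf : QPBound ω E s M f) : QPBound ω E s M (fun x t => (starRingEnd ℂ) (f x t)) := by
  obtain ⟨ι, k, c, m, hc, hsum, hle, hf⟩ := hf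
  refine ⟨ι, fun i => -k i, fun i x => (starRingEnd ℂ) (c i x), m, fun i => (hc i).conj,
    by simpa [order_neg] using hsum, by simpa [order_neg] using hle, fun x hx t => ?_⟩
  have := Complex.hasSum_conj'.2 (hf x hx t)
  simpa only [map_mul, wave_neg] using this

lemma smul (hf : QPBound ω E s M f) (hs : 0 ≤ s) (z : ℂ) :
    QPBound ω E s (‖z‖ * M) (fun x t => z * f x t) := (const z).mul hf hs

lemma neg (hf : QPBound ω E s M f) (hs : 0 ≤ s) : QPBound ω E s M (fun x t => -f x t) := by
  simpa using hf.smul hs (-1)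

lemma ofReal_re (hf : QPBound ω E s M f) (hs : 0 ≤ s) :
    QPBound ω E s M (fun x t => (((f x t).re : ℝ) : ℂ)) := by
  have h := (hf.add hf.conj hs).smul hs (1 / 2)
  refine (h.mono le_rfl le_rfl (le_of_eq ?_)).congr fun x _ t => ?_
  · norm_num; ring
  · rw [Complex.add_conj]; push_cast; ring

lemma ofReal_im (hf : QPBound ω E s M f) (hs : 0 ≤ s) :
    QPBound ω E s M (fun x t => (((f x t).im : ℝ) : ℂ)) := by
  have h := (hf.smul hs (-Complex.I)).ofReal_re hs
  simpa using h

lemma pow (hf : QPBound ω E s M f) (hs : 0 ≤ s) (n : ℕ) :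
    QPBound ω E s (M ^ n) (fun x t => f x t ^ n) := by
  induction n with
  | zero => simpa using const (ω := ω) (E := E) (s := s) 1
  | succ n ih => simpa [pow_succ] using ih.mul hf hs

lemma exp (hf : QPBound ω E s M f) (hs : 0 ≤ s) :
    QPBound ω E s (Real.exp M) (fun x t => Complex.exp (f x t)) := by
  refine hasSum (κ := ℕ) (M := fun n => M ^ n / n.factorial)
    (f := fun n x t => f x t ^ n / n.factorial) (fun n => ?_) hs ?_ fun x _ t => ?_
  · have := (hf.pow hs n).smul hs (1 / n.factorial)
    refine (this.mono le_rfl le_rfl (le_of_eq ?_)).congr fun x _ t => ?_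
    · simp; ring
    · ring
  · rw [Real.exp_eq_exp_ℝ]; exact NormedSpace.expSeries_div_hasSum_exp M
  · rw [Complex.exp_eq_exp_ℂ]; exact NormedSpace.expSeries_div_hasSum_exp (f x t)

lemma inv_one_sub (hf : QPBound ω E s M f) (hs : 0 ≤ s) (hM : M < 1) :
    QPBound ω E s (1 - M)⁻¹ (fun x t => (1 - f x t)⁻¹) := by
  refine hasSum (fun n : ℕ => hf.pow hs n) hs (hasSum_geometric_of_lt_one hf.nonneg hM)
    fun x hx t => hasSum_geometric_of_norm_lt_one ((hf.norm_le hs hx t).trans_lt hM)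

end QPBound

section Linear

/-! ### Linear equations with constant coefficients and quasi-periodic right-hand side -/

variable {r : ℕ} {ω : Fin r → ℝ} {E E' : Set ℝ} {s s' M K : ℝ} {f : ℝ → ℝ → ℂ}

/-- A Fourier multiplier `v` that solves `h' = A h + Λ (f - z m)` mode by mode, `m` being the mean
of `f`. It costs the factor `K` if the growth of `v` is dominated by the loss of width `s - s'`. -/
lemma exists_multiplier (hf : QPBound ω E s M f) (hE : E' ⊆ E) (hs : 0 ≤ s) (hs' : 0 ≤ s')
    {v : (Fin r → ℤ) → ℝ → ℂ} {μ : (Fin r → ℤ) → ℝ} (hv : ∀ k, LipBound E' (μ k) (v k))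
    (hK : ∀ k, μ k * Real.exp (s' * order k) ≤ K * Real.exp (s * order k))
    {A : ℝ → ℂ} {Λ z : ℂ} (hA : ∀ x ∈ E', ∀ k, freq ω k * Complex.I * v k x =
      A x * v k x + Λ * (1 - z * if k = 0 then 1 else 0)) :
    ∃ (m : ℝ → ℂ) (h : ℝ → ℝ → ℂ), LipBound E' M m ∧ QPBound ω E' s' (K * M) h ∧
      ∀ x ∈ E', ∀ t, HasDerivAt (h x) (A x * h x t + Λ * (f x t - z * m x)) t := by
  classical
  obtain ⟨ι, k, c, m, hc, hsum, hle, hf⟩ := hf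
  have hK0 : 0 ≤ K := by
    have := hK 0
    rw [order_zero, mul_zero, mul_zero, Real.exp_zero, mul_one, mul_one] at this
    exact (hv 0).1.trans this
  have hmsum : Summable m := Summable.of_nonneg_of_le (fun i => (hc i).1)
    (fun i => QPBound.le_weight hs (hc i).1 (k i)) hsum
  set n : ι → ℝ := fun i => μ (k i) * m i with hn
  have hn0 : ∀ i, 0 ≤ n i := fun i => mul_nonneg (hv _).1 (hc i).1
  have hncmp : ∀ i, n i * Real.exp (s' * order (k i)) ≤
      K * (m i * Real.exp (s * order (k i))) := fun i => by
    have := mul_le_mul_of_nonneg_right (hK (k i)) (hc i).1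
    simp only [hn]; nlinarith
  have hnsum := Summable.of_nonneg_of_le
    (fun i => mul_nonneg (hn0 i) (Real.exp_nonneg _)) hncmp (hsum.mul_left K)
  have hnsum0 : Summable n := Summable.of_nonneg_of_le hn0
    (fun i => QPBound.le_weight hs' (hn0 i) (k i)) hnsum
  have hvc : ∀ i, LipBound E' (n i) (fun x => v (k i) x * c i x) := fun i =>
    (hv (k i)).mul ((hc i).mono hE le_rfl)
  have hnorm : ∀ x ∈ E', ∀ i t, ‖v (k i) x * c i x * wave ω (k i) t‖ ≤ n i := fun x hx i t => by
    rw [norm_mul, norm_wave, mul_one]; exact (hvc i).2.1 x hx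
  have hcn : ∀ x ∈ E', ∀ i t, ‖c i x * wave ω (k i) t‖ ≤ m i := fun x hx i t => by
    rw [norm_mul, norm_wave, mul_one]; exact (hc i).2.1 x (hE hx)
  have hhsum : ∀ x ∈ E', ∀ t, Summable fun i => v (k i) x * c i x * wave ω (k i) t :=
    fun x hx t => Summable.of_norm_bounded hnsum0 fun i => hnorm x hx i t
  have hmean : ∀ i, LipBound E' (m i) (fun x => if k i = 0 then c i x else 0) := fun i => by
    by_cases hi : k i = 0
    · simpa [hi] using (hc i).mono hE le_rfl
    · simpa [hi] using (LipBound.const (E := E') 0).mono le_rfl (by simpa using (hc i).1)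
  refine ⟨fun x => ∑' i, if k i = 0 then c i x else 0,
    fun x t => ∑' i, v (k i) x * c i x * wave ω (k i) t, ?_, ?_, fun x hx t => ?_⟩
  · exact (LipBound.tsum hmean hmsum).mono le_rfl ((hmsum.tsum_le_tsum
      (fun i => QPBound.le_weight hs (hc i).1 (k i)) hsum).trans hle)
  · refine ⟨ι, k, fun i x => v (k i) x * c i x, n, hvc, hnsum, ?_,
      fun x hx t => (hhsum x hx t).hasSum⟩
    refine (hnsum.tsum_le_tsum hncmp (hsum.mul_left K)).trans ?_
    rw [tsum_mul_left]
    exact mul_le_mul_of_nonneg_left hle hK0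
  · have hmx : HasSum (fun i => if k i = 0 then c i x else 0)
        (∑' i, if k i = 0 then c i x else 0) :=
      (Summable.of_norm_bounded hmsum fun i => (hmean i).2.1 x hx).hasSum
    have hterm : ∀ i t, freq ω (k i) * Complex.I * (v (k i) x * c i x * wave ω (k i) t) =
        A x * (v (k i) x * c i x * wave ω (k i) t) +
          Λ * (c i x * wave ω (k i) t - z * if k i = 0 then c i x else 0) := fun i t => by
      have h1 : freq ω (k i) * Complex.I * (v (k i) x * c i x * wave ω (k i) t) =
          (freq ω (k i) * Complex.I * v (k i) x) * (c i x * wave ω (k i) t) := by ring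
      rw [h1, hA x hx (k i)]
      by_cases hi : k i = 0
      · rw [if_pos hi, if_pos hi, hi, wave_zero]; ring
      · rw [if_neg hi, if_neg hi]; ring
    have hd := hasDerivAt_tsum (u := fun i => ‖A x‖ * n i + ‖Λ‖ * (m i + ‖z‖ * m i)) (y₀ := t)
      (g := fun i t => v (k i) x * c i x * wave ω (k i) t)
      (g' := fun i t => freq ω (k i) * Complex.I * (v (k i) x * c i x * wave ω (k i) t))
      ((hnsum0.mul_left _).add ((hmsum.add (hmsum.mul_left _)).mul_left _))
      (fun i t => by
        have := (hasDerivAt_wave ω (k i) t).const_mul (v (k i) x * c i x)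
        refine this.congr_deriv ?_
        ring)
      (fun i t => by
        rw [hterm]
        refine (norm_add_le _ _).trans (add_le_add ?_ ?_)
        · rw [norm_mul]; exact mul_le_mul_of_nonneg_left (hnorm x hx i t) (norm_nonneg _)
        · rw [norm_mul]
          refine mul_le_mul_of_nonneg_left ((norm_sub_le _ _).trans (add_le_add (hcn x hx i t) ?_))
            (norm_nonneg _)
          rw [norm_mul]
          exact mul_le_mul_of_nonneg_left ((hmean i).2.1 x hx) (norm_nonneg _))
      (hhsum x hx t) t
    refine hd.congr_deriv ?_
    refine HasSum.tsum_eq ?_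
    simp only [hterm]
    exact ((hhsum x hx t).hasSum.mul_left _).add
      (((hf x (hE hx) t).sub (hmx.mul_left z)).mul_left Λ)

/-- Integration of a quasi-periodic function minus its mean. -/
lemma exists_primitive (hf : QPBound ω E s M f) (hs : 0 ≤ s) (hs' : 0 ≤ s') (hK0 : 0 ≤ K)
    (hK : ∀ k ≠ 0, Real.exp (s' * order k) ≤ K * |freq ω k| * Real.exp (s * order k)) :
    ∃ (m : ℝ → ℂ) (h : ℝ → ℝ → ℂ), LipBound E M m ∧ QPBound ω E s' (K * M) h ∧
      ∀ x ∈ E, ∀ t, HasDerivAt (h x) (f x t - m x) t := by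
  classical
  have hne : ∀ k ≠ 0, 0 < |freq ω k| := fun k hk => by
    rcases (abs_nonneg (freq ω k)).lt_or_eq with h | h
    · exact h
    · have := hK k hk
      rw [← h, mul_zero, zero_mul] at this
      exact absurd this (not_le.2 (Real.exp_pos _))
  have hv : ∀ k : Fin r → ℤ, LipBound E (if k = 0 then 0 else |freq ω k|⁻¹)
      (fun _ => if k = 0 then 0 else (freq ω k * Complex.I : ℂ)⁻¹) := fun k => by
    have := LipBound.const (E := E) (if k = 0 then 0 else (freq ω k * Complex.I : ℂ)⁻¹)
    refine this.mono le_rfl ?_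
    split_ifs <;> simp
  obtain ⟨m, h, h1, h2, h3⟩ := exists_multiplier (K := K) (A := 0) (Λ := 1) (z := 1)
    hf le_rfl hs hs' hv (fun k => by
      split_ifs with h
      · rw [zero_mul]; positivity
      · rw [inv_mul_le_iff₀ (hne k h)]
        have := hK k h
        linarith) (fun x hx k => by
      split_ifs with h
      · simp
      · have : (freq ω k : ℂ) ≠ 0 := by
          exact_mod_cast abs_pos.1 (hne k h)
        simp only [Pi.zero_apply]
        field_simp
        simp)
  exact ⟨m, h, h1, h2, fun x hx t => (h3 x hx t).congr_deriv (by simp)⟩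

/-- Quasi-periodic solution of `h' = 2iΛℓ h + Λ f` for a parameter-dependent nonresonant `ℓ`. -/
lemma exists_forced_response (hf : QPBound ω E s M f) (hE : E' ⊆ E) (hs : 0 ≤ s) (hs' : 0 ≤ s')
    {Λ : ℝ} (hΛ : 0 < Λ) {ℓ : ℝ → ℝ} {d : (Fin r → ℤ) → ℝ} (hd0 : ∀ k, 0 < d k)
    (hd : ∀ x ∈ E', ∀ k, Λ * d k ≤ |freq ω k - 2 * Λ * ℓ x|)
    (hℓ : ∀ x ∈ E', ∀ y ∈ E', |ℓ x - ℓ y| ≤ |x - y|)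
    (hK : ∀ k, (1 / d k + 2 / d k ^ 2) * Real.exp (s' * order k) ≤ K * Real.exp (s * order k)) :
    ∃ h : ℝ → ℝ → ℂ, QPBound ω E' s' (K * M) h ∧
      ∀ x ∈ E', ∀ t, HasDerivAt (h x) (2 * Λ * ℓ x * Complex.I * h x t + Λ * f x t) t := by
  have hΛC : (Λ : ℂ) ≠ 0 := by exact_mod_cast hΛ.ne'
  set D : (Fin r → ℤ) → ℝ → ℂ := fun k x =>
    (((freq ω k - 2 * Λ * ℓ x) / Λ : ℝ) : ℂ) * Complex.I with hD
  have hDn : ∀ x ∈ E', ∀ k, d k ≤ ‖D k x‖ := fun x hx k => by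
    simp only [hD, norm_mul, Complex.norm_I, mul_one, Complex.norm_real, Real.norm_eq_abs, abs_div,
      abs_of_pos hΛ]
    rw [le_div_iff₀ hΛ, mul_comm]
    exact hd x hx k
  have hv : ∀ k : Fin r → ℤ, LipBound E' (1 / d k + 2 / d k ^ 2) (fun x => (D k x)⁻¹) :=
    fun k => LipBound.inv (hd0 k) (by norm_num) (fun x hx => hDn x hx k) fun x hx y hy => by
      have e : D k x - D k y = ((-2 * (ℓ x - ℓ y) : ℝ) : ℂ) * Complex.I := by
        simp only [hD]; push_cast; field_simp; ring
      rw [e, norm_mul, Complex.norm_I, mul_one, Complex.norm_real, Real.norm_eq_abs, abs_mul]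
      have := hℓ x hx y hy
      norm_num; linarith
  obtain ⟨m, h, -, h2, h3⟩ := exists_multiplier (K := K)
    (A := fun x => 2 * Λ * ℓ x * Complex.I) (Λ := Λ) (z := 0) hf hE hs hs' hv hK
    (fun x hx k => by
      have hne : D k x ≠ 0 := norm_pos_iff.1 ((hd0 k).trans_le (hDn x hx k))
      have e : (freq ω k * Complex.I : ℂ) = 2 * Λ * ℓ x * Complex.I + Λ * D k x := by
        simp only [hD]; push_cast; field_simp; ring
      rw [e, add_mul, mul_assoc (Λ : ℂ), mul_inv_cancel₀ hne]; simp)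
  exact ⟨h, h2, fun x hx t => (h3 x hx t).congr_deriv (by simp)⟩

end Linear

/-! ### Growth of solutions of `u' = i p u + q ū` and its change under coordinate transformations -/

/-- Every solution of the real-linear system `u' = i p u + q ū`, `p` real, on any interval
`[t₀, T]` grows at most like `C e^{γ (t - t₀)}`. Every traceless real planar linear system has this
form in a complex coordinate. -/
def GrowthBound (C γ : ℝ) (p : ℝ → ℝ) (q : ℝ → ℂ) : Prop :=
  ∀ (t₀ T : ℝ) (u : ℝ → ℂ),
    (∀ t ∈ Set.Icc t₀ T, HasDerivWithinAt u
      (p t * Complex.I * u t + q t * (starRingEnd ℂ) (u t)) (Set.Icc t₀ T) t) →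
    ∀ t ∈ Set.Icc t₀ T, ‖u t‖ ≤ C * Real.exp (γ * (t - t₀)) * ‖u t₀‖

namespace GrowthBound

variable {C γ : ℝ} {p p₁ : ℝ → ℝ} {q : ℝ → ℂ}

/-- The diagonal term does not contribute to the growth of `|u|²`. -/
lemma of_norm_le (hq : ∀ t, ‖q t‖ ≤ γ) : GrowthBound 1 γ p q := by
  intro t₀ T u hu t ht
  have hN : ∀ τ ∈ Set.Icc t₀ T, HasDerivWithinAt
      (fun τ => ‖u τ‖ ^ 2 * Real.exp (-(2 * γ) * (τ - t₀)))
      ((2 * (q τ * (starRingEnd ℂ) (u τ) ^ 2).re) * Real.exp (-(2 * γ) * (τ - t₀)) +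
        ‖u τ‖ ^ 2 * (Real.exp (-(2 * γ) * (τ - t₀)) * (-(2 * γ)))) (Set.Icc t₀ T) τ := by
    intro τ hτ
    have h1 := (hu τ hτ).norm_sq
    have h2 : HasDerivAt (fun τ => Real.exp (-(2 * γ) * (τ - t₀)))
        (Real.exp (-(2 * γ) * (τ - t₀)) * (-(2 * γ))) τ := by
      have := (((hasDerivAt_id τ).sub_const t₀).const_mul (-(2 * γ))).exp
      simpa using this
    refine (h1.mul h2.hasDerivWithinAt).congr_deriv ?_
    congr 2
    rw [Complex.inner]
    simp only [Complex.mul_re, Complex.add_re, Complex.conj_re, Complex.conj_im, Complex.add_im,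
      Complex.mul_im, Complex.ofReal_re, Complex.ofReal_im, Complex.I_re, Complex.I_im, pow_two]
    ring
  have hanti : AntitoneOn (fun τ => ‖u τ‖ ^ 2 * Real.exp (-(2 * γ) * (τ - t₀)))
      (Set.Icc t₀ T) := by
    refine antitoneOn_of_hasDerivWithinAt_nonpos (convex_Icc _ _)
      (fun τ hτ => (hN τ hτ).continuousWithinAt)
      (fun τ hτ => (hN τ (interior_subset hτ)).mono interior_subset) fun τ _ => ?_
    have h3 : (q τ * (starRingEnd ℂ) (u τ) ^ 2).re ≤ γ * ‖u τ‖ ^ 2 := by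
      refine (Complex.re_le_norm _).trans ?_
      rw [norm_mul, norm_pow, RCLike.norm_conj]
      exact mul_le_mul_of_nonneg_right (hq τ) (by positivity)
    nlinarith [Real.exp_pos (-(2 * γ) * (τ - t₀))]
  have h := hanti ⟨le_rfl, ht.1.trans ht.2⟩ ht ht.1
  simp only [sub_self, mul_zero, Real.exp_zero, mul_one] at h
  rw [one_mul]
  refine abs_le_of_sq_le_sq' ?_ (by positivity) |>.2
  have e : Real.exp (γ * (t - t₀)) ^ 2 * Real.exp (-(2 * γ) * (t - t₀)) = 1 := by
    rw [← Real.exp_nat_mul, ← Real.exp_add]; simp; ring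
  calc ‖u t‖ ^ 2 = Real.exp (γ * (t - t₀)) ^ 2 *
        (‖u t‖ ^ 2 * Real.exp (-(2 * γ) * (t - t₀))) := by
        linear_combination (-‖u t‖ ^ 2) * e
    _ ≤ Real.exp (γ * (t - t₀)) ^ 2 * ‖u t₀‖ ^ 2 := by gcongr
    _ = _ := by ring

/-- The rotation `u = e^{iφ} w` with `φ' = p - p₁`. -/
lemma of_rotation {φ : ℝ → ℝ} (hφ : ∀ t, HasDerivAt φ (p t - p₁ t) t)
    (h : GrowthBound C γ p₁ fun t => q t * Complex.exp (-2 * Complex.I * φ t)) :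
    GrowthBound C γ p q := by
  intro t₀ T u hu t ht
  have hw : ∀ t, ‖Complex.exp (-(Complex.I * φ t)) * u t‖ = ‖u t‖ := fun t => by
    rw [norm_mul, Complex.norm_exp]; simp
  have := h t₀ T (fun t => Complex.exp (-(Complex.I * φ t)) * u t) (fun τ hτ => ?_) t ht
  · simpa only [hw] using this
  · have h1 : HasDerivAt (fun τ => Complex.exp (-(Complex.I * φ τ)))
        (Complex.exp (-(Complex.I * φ τ)) * (-(Complex.I * (p τ - p₁ τ : ℝ)))) τ :=
      (((hφ τ).ofReal_comp.const_mul Complex.I).neg).cexp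
    refine (h1.hasDerivWithinAt.mul (hu τ hτ)).congr_deriv ?_
    have e1 : (starRingEnd ℂ) (Complex.exp (-(Complex.I * φ τ))) =
        Complex.exp (Complex.I * φ τ) := by
      rw [← Complex.exp_conj]; simp
    have e2 : Complex.exp (-2 * Complex.I * φ τ) * Complex.exp (Complex.I * φ τ) =
        Complex.exp (-(Complex.I * φ τ)) := by
      rw [← Complex.exp_add]; ring_nf
    simp only [map_mul, e1]
    linear_combination (norm := (push_cast; ring_nf)) (-(q τ * (starRingEnd ℂ) (u τ))) * e2

/-- The hyperbolic transformation `w = (u - h ū) / √(1 - |h|²)`, where `h` solves the linearized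
equation. The new off-diagonal term is cubic in `(h, q)`. -/
lemma of_hyperbolic {l η : ℝ} {h : ℝ → ℂ} (hη : η < 1) (hhη : ∀ t, ‖h t‖ ≤ η) (hC : 0 ≤ C)
    (hh : ∀ t, HasDerivAt h (2 * l * Complex.I * h t + q t) t)
    (hg : GrowthBound C γ
      (fun t => l - (h t * (starRingEnd ℂ) (q t)).im / (1 - ‖h t‖ ^ 2))
      (fun t => -(h t ^ 2 * (starRingEnd ℂ) (q t) / (1 - ‖h t‖ ^ 2 : ℝ)))) :
    GrowthBound (C * ((1 + η) / (1 - η))) γ (fun _ => l) q := by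
  intro t₀ T u hu t ht
  have hη0 : 0 ≤ η := (norm_nonneg _).trans (hhη 0)
  have hN : ∀ τ, 0 < 1 - ‖h τ‖ ^ 2 := fun τ => by nlinarith [hhη τ, norm_nonneg (h τ)]
  set w : ℝ → ℂ := fun τ =>
    (((√(1 - ‖h τ‖ ^ 2))⁻¹ : ℝ) : ℂ) * (u τ - h τ * (starRingEnd ℂ) (u τ)) with hw
  have hwn : ∀ τ, ‖w τ‖ ^ 2 = ‖u τ - h τ * (starRingEnd ℂ) (u τ)‖ ^ 2 / (1 - ‖h τ‖ ^ 2) :=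
    fun τ => by
      simp only [hw]
      rw [norm_mul, mul_pow, Complex.norm_real, Real.norm_eq_abs, sq_abs, inv_pow,
        Real.sq_sqrt (hN τ).le]
      ring
  have hcmp : ∀ τ, (1 + ‖h τ‖) / (1 - ‖h τ‖) ≤ (1 + η) / (1 - η) := fun τ => by
    have := hhη τ
    rw [div_le_div_iff₀ (by linarith) (by linarith)]; nlinarith
  have hle : ∀ τ, ‖w τ‖ ^ 2 ≤ (1 + η) / (1 - η) * ‖u τ‖ ^ 2 := fun τ => by
    have h1 : ‖u τ - h τ * (starRingEnd ℂ) (u τ)‖ ≤ (1 + ‖h τ‖) * ‖u τ‖ := by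
      refine (norm_sub_le _ _).trans (le_of_eq ?_)
      rw [norm_mul, RCLike.norm_conj]; ring
    have hpos : 0 < 1 - ‖h τ‖ := by linarith [hhη τ]
    rw [hwn, div_le_iff₀ (hN τ)]
    calc _ ≤ ((1 + ‖h τ‖) * ‖u τ‖) ^ 2 := by gcongr
      _ = (1 + ‖h τ‖) / (1 - ‖h τ‖) * ‖u τ‖ ^ 2 * (1 - ‖h τ‖ ^ 2) := by field_simp; ring
      _ ≤ _ := by
        have := hcmp τ
        have := hN τ
        gcongr
  have hge : ∀ τ, ‖u τ‖ ^ 2 ≤ (1 + η) / (1 - η) * ‖w τ‖ ^ 2 := fun τ => by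
    have h1 : (1 - ‖h τ‖) * ‖u τ‖ ≤ ‖u τ - h τ * (starRingEnd ℂ) (u τ)‖ := by
      refine le_trans (le_of_eq ?_) (norm_sub_norm_le _ _)
      rw [norm_mul, RCLike.norm_conj]; ring
    have hpos : 0 < 1 - ‖h τ‖ := by linarith [hhη τ]
    rw [hwn, ← mul_div_assoc, le_div_iff₀ (hN τ)]
    calc _ = (1 + ‖h τ‖) / (1 - ‖h τ‖) * ((1 - ‖h τ‖) * ‖u τ‖) ^ 2 := by field_simp; ring
      _ ≤ (1 + ‖h τ‖) / (1 - ‖h τ‖) * ‖u τ - h τ * (starRingEnd ℂ) (u τ)‖ ^ 2 := by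
        gcongr
      _ ≤ _ := by
        have := hcmp τ
        gcongr
  have hwt := hg t₀ T w (fun τ hτ => ?_) t ht
  · refine abs_le_of_sq_le_sq' ?_ ?_ |>.2
    · have hρ : 0 ≤ (1 + η) / (1 - η) := div_nonneg (by linarith) (by linarith)
      calc ‖u t‖ ^ 2 ≤ (1 + η) / (1 - η) * ‖w t‖ ^ 2 := hge t
        _ ≤ (1 + η) / (1 - η) * (C * Real.exp (γ * (t - t₀)) * ‖w t₀‖) ^ 2 := by gcongr
        _ = (1 + η) / (1 - η) * (C * Real.exp (γ * (t - t₀))) ^ 2 * ‖w t₀‖ ^ 2 := by ring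
        _ ≤ (1 + η) / (1 - η) * (C * Real.exp (γ * (t - t₀))) ^ 2 *
            ((1 + η) / (1 - η) * ‖u t₀‖ ^ 2) := by
          have := hle t₀
          gcongr
        _ = _ := by ring
    · have hρ : 0 ≤ (1 + η) / (1 - η) := div_nonneg (by linarith) (by linarith)
      positivity
  · have hd1 : HasDerivAt (fun τ => 1 - ‖h τ‖ ^ 2) (-(2 * (h τ * (starRingEnd ℂ) (q τ)).re)) τ := by
      refine ((hh τ).norm_sq.const_sub 1).congr_deriv ?_
      rw [Complex.inner]
      congr 2
      simp only [Complex.mul_re, Complex.add_re, Complex.conj_re, Complex.conj_im, Complex.add_im,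
        Complex.mul_im, Complex.ofReal_re, Complex.ofReal_im, Complex.I_re, Complex.I_im,
        Complex.re_ofNat, Complex.im_ofNat]
      ring
    have hd2 := (hd1.sqrt (hN τ).ne').inv (Real.sqrt_pos.2 (hN τ)).ne'
    have hd3 := hd2.ofReal_comp.hasDerivWithinAt (s := Set.Icc t₀ T)
    have hd4 := (hu τ hτ).sub ((hh τ).hasDerivWithinAt.mul (hu τ hτ).star)
    refine (hd3.mul hd4).congr_deriv ?_
    set S : ℝ := √(1 - ‖h τ‖ ^ 2) with hS
    have hS2 : S ^ 2 = 1 - ‖h τ‖ ^ 2 := Real.sq_sqrt (hN τ).le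
    have hS0 : (S : ℂ) ≠ 0 := by exact_mod_cast (Real.sqrt_pos.2 (hN τ)).ne'
    have hSC : (S : ℂ) ^ 2 = 1 - h τ * (starRingEnd ℂ) (h τ) := by
      rw [← Complex.ofReal_pow, hS2, Complex.mul_conj, Complex.normSq_eq_norm_sq]; push_cast; ring
    have hre : (((h τ * (starRingEnd ℂ) (q τ)).re : ℝ) : ℂ) =
        (h τ * (starRingEnd ℂ) (q τ) + (starRingEnd ℂ) (h τ) * q τ) / 2 := by
      rw [Complex.re_eq_add_conj]; simp
    have him : (((h τ * (starRingEnd ℂ) (q τ)).im : ℝ) : ℂ) =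
        (h τ * (starRingEnd ℂ) (q τ) - (starRingEnd ℂ) (h τ) * q τ) / (2 * Complex.I) := by
      rw [Complex.im_eq_sub_conj]; simp
    have hSS : √(S ^ 2) = S := Real.sqrt_sq (Real.sqrt_nonneg _)
    simp only [Pi.sub_apply, Pi.mul_apply, Pi.inv_apply, hw, ← hS2, hSS, map_mul, map_sub, Complex.conj_ofReal, RCLike.conj_conj,
      Complex.star_def, map_add, Complex.conj_I]
    push_cast
    rw [hre, him]
    generalize (starRingEnd ℂ) (h τ) = H' at *
    generalize (starRingEnd ℂ) (q τ) = Q' at *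
    generalize (starRingEnd ℂ) (u τ) = U' at *
    generalize h τ = H at *
    generalize q τ = Q at *
    generalize u τ = U at *
    field_simp
    linear_combination (-2 * H * Q' * U) * hSC

end GrowthBound

section Iteration

/-! ### One step of the iteration -/

variable {r : ℕ} {ω : Fin r → ℝ} {E E' : Set ℝ} {s s' s₁ M N K δ Λ : ℝ} {ℓ : ℝ → ℝ}
  {Q : ℝ → ℝ → ℂ}

/-- The oscillating part of the diagonal is removed by a rotation. The phase is real, so the
off-diagonal term only acquires a factor of modulus one. -/
lemma exists_diagonal_average {P : ℝ → ℝ → ℝ} (hP : QPBound ω E s M fun x t => (P x t : ℂ))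
    (hQ : QPBound ω E s N Q) (hs' : 0 ≤ s') (hss : s' ≤ s) (hK0 : 0 ≤ K)
    (hK : ∀ k ≠ 0, Real.exp (s' * order k) ≤ K * |freq ω k| * Real.exp (s * order k))
    (hΛ : 0 < Λ) (hΛ1 : Λ ≤ 1) :
    ∃ (m : ℝ → ℝ) (Q' : ℝ → ℝ → ℂ), LipBound E M (fun x => (m x : ℂ)) ∧
      QPBound ω E s' (N * Real.exp (2 * (K * M))) Q' ∧
      ∀ x ∈ E, ∀ C γ, GrowthBound C γ (fun _ => Λ * (ℓ x + m x)) (fun t => Λ * Q' x t) →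
        GrowthBound C γ (fun t => Λ * (ℓ x + P x t)) (fun t => Λ * Q x t) := by
  have hs : 0 ≤ s := hs'.trans hss
  obtain ⟨m, G, hm, hG, hd⟩ := exists_primitive hP hs hs' hK0 hK
  refine ⟨fun x => (m x).re,
    fun x t => Q x t * Complex.exp (-2 * Complex.I * (Λ * (G x t).re : ℝ)), hm.ofReal_re, ?_, ?_⟩
  · have h1 := (hG.ofReal_re hs').smul hs' (-2 * Complex.I * Λ)
    have h2 : QPBound ω E s' (2 * (K * M))
        (fun x t => -2 * Complex.I * (Λ * (G x t).re : ℝ)) := by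
      refine (h1.mono le_rfl le_rfl ?_).congr fun x _ t => by push_cast; ring
      have hKM := hG.nonneg
      simp only [norm_mul, norm_neg, Complex.norm_I, Complex.norm_real, Real.norm_eq_abs,
        abs_of_pos hΛ]
      norm_num
      nlinarith
    exact (hQ.mono le_rfl hss le_rfl).mul (h2.exp hs') hs'
  · intro x hx C γ hg
    refine GrowthBound.of_rotation (p₁ := fun _ => Λ * (ℓ x + (m x).re))
      (φ := fun t => Λ * (G x t).re) (fun t => ?_) ?_
    · have h3 := (hd x hx t)
      have h4 : HasDerivAt (fun t => (G x t).re) ((P x t - m x : ℂ).re) t :=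
        (Complex.reCLM.hasFDerivAt.comp_hasDerivAt t h3)
      refine (h4.const_mul Λ).congr_deriv ?_
      rw [Complex.sub_re, Complex.ofReal_re]; ring
    · simpa only [mul_assoc] using hg

/-- A hyperbolic transformation makes the off-diagonal term cubically small, at the price of a
quadratically small oscillating diagonal term. -/
lemma exists_offdiagonal_reduction (hQ : QPBound ω E s δ Q) (hE : E' ⊆ E) (hs : 0 ≤ s)
    (hs' : 0 ≤ s') (hss : s' ≤ s) (hΛ : 0 < Λ) {d : (Fin r → ℤ) → ℝ} (hd0 : ∀ k, 0 < d k)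
    (hd : ∀ x ∈ E', ∀ k, Λ * d k ≤ |freq ω k - 2 * Λ * ℓ x|)
    (hℓ : ∀ x ∈ E', ∀ y ∈ E', |ℓ x - ℓ y| ≤ |x - y|)
    (hK : ∀ k, (1 / d k + 2 / d k ^ 2) * Real.exp (s' * order k) ≤ K * Real.exp (s * order k))
    (hη : K * δ < 1) :
    ∃ (P : ℝ → ℝ → ℝ) (Q' : ℝ → ℝ → ℂ),
      QPBound ω E' s' (K * δ * δ * (1 - (K * δ) ^ 2)⁻¹) (fun x t => (P x t : ℂ)) ∧
      QPBound ω E' s' ((K * δ) ^ 2 * δ * (1 - (K * δ) ^ 2)⁻¹) Q' ∧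
      ∀ x ∈ E', ∀ C γ, 0 ≤ C →
        GrowthBound C γ (fun t => Λ * (ℓ x + P x t)) (fun t => Λ * Q' x t) →
        GrowthBound (C * ((1 + K * δ) / (1 - K * δ))) γ (fun _ => Λ * ℓ x)
          (fun t => Λ * Q x t) := by
  obtain ⟨h, hh, hderiv⟩ := exists_forced_response hQ hE hs hs' hΛ hd0 hd hℓ hK
  have hη0 := hh.nonneg
  have hQ' : QPBound ω E' s' δ Q := hQ.mono hE hss le_rfl
  have hsq : QPBound ω E' s' ((K * δ) ^ 2) (fun x t => ((‖h x t‖ ^ 2 : ℝ) : ℂ)) := by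
    rw [pow_two]
    refine (hh.mul hh.conj hs').congr fun x _ t => ?_
    rw [Complex.mul_conj, Complex.normSq_eq_norm_sq]
  have hinv := hsq.inv_one_sub hs' (by nlinarith)
  have hhQ := (hh.mul hQ'.conj hs').ofReal_im hs'
  refine ⟨fun x t => -(h x t * (starRingEnd ℂ) (Q x t)).im / (1 - ‖h x t‖ ^ 2),
    fun x t => -(h x t ^ 2 * (starRingEnd ℂ) (Q x t) / (1 - ‖h x t‖ ^ 2 : ℝ)), ?_, ?_, ?_⟩
  · refine ((hhQ.neg hs').mul hinv hs').congr fun x _ t => ?_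
    push_cast; rw [div_eq_mul_inv]
  · refine ((((hh.pow hs' 2).mul hQ'.conj hs').mul hinv hs').neg hs').congr fun x _ t => ?_
    push_cast; rw [div_eq_mul_inv]
  · intro x hx C γ hC hg
    refine GrowthBound.of_hyperbolic (h := h x) hη (fun t => hh.norm_le hs' hx t) hC
      (fun t => ?_) ?_
    · refine (hderiv x hx t).congr_deriv ?_
      push_cast; ring
    · convert hg using 2 with t t
      · have : (h x t * (starRingEnd ℂ) (Λ * Q x t)).im =
            Λ * (h x t * (starRingEnd ℂ) (Q x t)).im := by
          rw [map_mul, Complex.conj_ofReal, mul_left_comm, Complex.im_ofReal_mul]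
        rw [this]; ring
      · rw [map_mul, Complex.conj_ofReal]; ring

/-- The parameters in `E` at which `2Λℓ` stays away from every frequency `⟨k, ω⟩`, with a bound
that decays polynomially in `|k|` and exponentially in the number `n` of the step. -/
def nonresonant {r : ℕ} (ω : Fin r → ℝ) (T : ℕ) (Λ : ℝ) (n : ℕ) (E : Set ℝ) (ℓ : ℝ → ℝ) :
    Set ℝ :=
  {x ∈ E | ∀ k : Fin r → ℤ, Λ * (2 ^ n * (1 + order k) ^ T)⁻¹ ≤ |freq ω k - 2 * Λ * ℓ x|}

lemma nonresonant_subset {T n : ℕ} : nonresonant ω T Λ n E ℓ ⊆ E := fun _ hx => hx.1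

/-- One step of the iteration: a hyperbolic transformation followed by a rotation. -/
lemma exists_step {T n : ℕ} (hQ : QPBound ω E s δ Q) (hs' : 0 ≤ s') (hs₁ : s' ≤ s₁) (hs : s₁ ≤ s)
    (hΛ : 0 < Λ) (hΛ1 : Λ ≤ 1) (hℓ : ∀ x ∈ E, ∀ y ∈ E, |ℓ x - ℓ y| ≤ |x - y|) (hK0 : 0 ≤ K)
    (hK1 : ∀ k : Fin r → ℤ, 3 * (2 ^ n * (1 + order k) ^ T) ^ 2 * Real.exp (s₁ * order k) ≤
      K * Real.exp (s * order k))
    (hK2 : ∀ k ≠ 0, Real.exp (s' * order k) ≤ K * |freq ω k| * Real.exp (s₁ * order k))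
    (hη : K * δ ≤ 1 / 4) :
    ∃ (ℓ' : ℝ → ℝ) (Q' : ℝ → ℝ → ℂ),
      LipBound (nonresonant ω T Λ n E ℓ) (2 * (K * δ) * δ) (fun x => (ℓ' x - ℓ x : ℂ)) ∧
      QPBound ω (nonresonant ω T Λ n E ℓ) s' (4 * (K * δ) ^ 2 * δ) Q' ∧
      ∀ x ∈ nonresonant ω T Λ n E ℓ, ∀ C γ, 0 ≤ C →
        GrowthBound C γ (fun _ => Λ * ℓ' x) (fun t => Λ * Q' x t) →
        GrowthBound (C * ((1 + K * δ) / (1 - K * δ))) γ (fun _ => Λ * ℓ x)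
          (fun t => Λ * Q x t) := by
  have hδ := hQ.nonneg
  -- for `d ≤ 1` the multiplier bound `1/d + 2/d²` is at most `3/d²`
  have hpos : ∀ k : Fin r → ℤ, 1 ≤ (2 : ℝ) ^ n * (1 + order k) ^ T := fun k =>
    one_le_mul_of_one_le_of_one_le (one_le_pow₀ (by norm_num))
      (one_le_pow₀ (by linarith [order_nonneg k]))
  obtain ⟨P, Q₁, hP, hQ₁, hg₁⟩ := exists_offdiagonal_reduction (K := K) (s' := s₁)
    (E' := nonresonant ω T Λ n E ℓ) (d := fun k => (2 ^ n * (1 + order k) ^ T)⁻¹)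
    hQ nonresonant_subset (hs'.trans (hs₁.trans hs)) (hs'.trans hs₁) hs hΛ
    (fun k => inv_pos.2 (zero_lt_one.trans_le (hpos k))) (fun x hx k => hx.2 k)
    (fun x hx y hy => hℓ x hx.1 y hy.1)
    (fun k => (mul_le_mul_of_nonneg_right (by
      have := hpos k
      rw [one_div, inv_inv, inv_pow, div_inv_eq_mul]
      nlinarith) (Real.exp_nonneg _)).trans (hK1 k)) (by linarith)
  obtain ⟨m, Q₂, hm, hQ₂, hg₂⟩ := exists_diagonal_average (ℓ := ℓ) hP hQ₁ hs' hs₁ hK0 hK2 hΛ hΛ1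
  set η := K * δ with hηdef
  have hη0 : 0 ≤ η := mul_nonneg hK0 hδ
  have hinv : (1 - η ^ 2)⁻¹ ≤ 16 / 15 := by
    rw [inv_le_comm₀ (by nlinarith) (by norm_num)]; nlinarith
  have hinv0 : 0 ≤ (1 - η ^ 2)⁻¹ := inv_nonneg.2 (by nlinarith)
  refine ⟨fun x => ℓ x + m x, Q₂, (hm.congr fun x _ => by push_cast; ring).mono le_rfl ?_,
    hQ₂.mono le_rfl le_rfl ?_, fun x hx C γ hC hg => hg₁ x hx C γ hC (hg₂ x hx C γ hg)⟩
  · have : 0 ≤ η * δ := mul_nonneg hη0 hδ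
    nlinarith
  · have h1 : 2 * (K * (η * δ * (1 - η ^ 2)⁻¹)) ≤ 1 / 2 := by
      have e : 2 * (K * (η * δ * (1 - η ^ 2)⁻¹)) = 2 * η ^ 2 * (1 - η ^ 2)⁻¹ := by
        rw [hηdef]; ring
      rw [e]; nlinarith
    have h2 : Real.exp (2 * (K * (η * δ * (1 - η ^ 2)⁻¹))) ≤ 3 := by
      refine (Real.exp_le_exp.2 (h1.trans (by norm_num : (1 / 2 : ℝ) ≤ 1))).trans ?_
      linarith [Real.exp_one_lt_d9]
    have h3 : η ^ 2 * δ * (1 - η ^ 2)⁻¹ ≤ η ^ 2 * δ * (4 / 3) := by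
      gcongr
      linarith
    calc _ ≤ η ^ 2 * δ * (4 / 3) * 3 := by gcongr
      _ = _ := by ring

/-! ### The iteration -/

/-- The factor lost when the width shrinks from `s/2 + s/2^{n+1}` to `s/2 + s/2^{n+2}` grows only
geometrically in `n`. -/
lemma exists_geometric_loss {T : ℕ} {A : ℝ} (hA : 0 ≤ A)
    (hω : ∀ k : Fin r → ℤ, k ≠ 0 → 1 ≤ A * (1 + order k) ^ T * |freq ω k|) (hs : 0 < s) :
    ∃ K₀ B : ℝ, 0 < K₀ ∧ 1 ≤ B ∧ ∀ n : ℕ, ∃ s₁, s / 2 + s / 2 ^ (n + 2) ≤ s₁ ∧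
      s₁ ≤ s / 2 + s / 2 ^ (n + 1) ∧
      (∀ k : Fin r → ℤ, 3 * (2 ^ n * (1 + order k) ^ T) ^ 2 * Real.exp (s₁ * order k) ≤
        K₀ * B ^ n * Real.exp ((s / 2 + s / 2 ^ (n + 1)) * order k)) ∧
      (∀ k ≠ 0, Real.exp ((s / 2 + s / 2 ^ (n + 2)) * order k) ≤
        K₀ * B ^ n * |freq ω k| * Real.exp (s₁ * order k)) := by
  refine ⟨(3 + A) * ((2 * T).factorial * (8 / s) ^ (2 * T) * Real.exp s), 4 ^ (T + 1),
    by positivity, one_le_pow₀ (by norm_num), fun n => ?_⟩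
  -- each half-step loses the width `σ`, and `(1 + |k|)^{2T} ≤ (2T)! σ^{-2T} e^{σ(1 + |k|)}`
  set σ : ℝ := s / 2 ^ (n + 3) with hσ
  have hσ0 : 0 < σ := by positivity
  have hσs : σ ≤ s := div_le_self hs.le (one_le_pow₀ (by norm_num))
  set D : ℝ := (2 * T).factorial * (8 / s) ^ (2 * T) * Real.exp s with hD
  have hD0 : 0 < D := by positivity
  have e2 : s / 2 ^ (n + 2) = 2 * σ := by rw [hσ, pow_succ (2 : ℝ) (n + 2)]; field_simp
  have e1 : s / 2 ^ (n + 1) = 4 * σ := by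
    rw [hσ, pow_succ (2 : ℝ) (n + 2), pow_succ (2 : ℝ) (n + 1)]; field_simp; norm_num
  have h4 : ((4 : ℝ) ^ (T + 1)) ^ n = (2 ^ n) ^ 2 * (2 ^ n) ^ (2 * T) := by
    rw [show (4 : ℝ) = 2 ^ 2 by norm_num]; simp only [← pow_mul, ← pow_add]; ring_nf
  have key : ∀ k : Fin r → ℤ, (1 + order k) ^ (2 * T) ≤
      D * (2 ^ n) ^ (2 * T) * Real.exp (σ * order k) := fun k => by
    have hk := order_nonneg k
    have h := Real.pow_div_factorial_le_exp (σ * (1 + order k)) (by positivity) (2 * T)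
    rw [div_le_iff₀ (by positivity), mul_pow] at h
    have hp : 0 < σ ^ (2 * T) := by positivity
    have e3 : D * (2 ^ n) ^ (2 * T) * σ ^ (2 * T) = (2 * T).factorial * Real.exp s := by
      have : 8 / s * 2 ^ n * σ = 1 := by
        rw [hσ, pow_add]; field_simp; norm_num
      calc _ = (2 * T).factorial * Real.exp s * (8 / s * 2 ^ n * σ) ^ (2 * T) := by
            rw [hD, mul_pow, mul_pow]; ring
        _ = _ := by rw [this, one_pow, mul_one]
    refine le_of_mul_le_mul_left ?_ hp
    calc σ ^ (2 * T) * (1 + order k) ^ (2 * T)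
        ≤ Real.exp (σ * (1 + order k)) * (2 * T).factorial := h
      _ = Real.exp σ * Real.exp (σ * order k) * (2 * T).factorial := by
        rw [← Real.exp_add]; ring_nf
      _ ≤ Real.exp s * Real.exp (σ * order k) * (2 * T).factorial := by gcongr
      _ = (D * (2 ^ n) ^ (2 * T) * σ ^ (2 * T)) * Real.exp (σ * order k) := by rw [e3]; ring
      _ = _ := by ring
  refine ⟨s / 2 + 3 * σ, by linarith, by linarith, fun k => ?_, fun k hk => ?_⟩
  · have e : Real.exp ((s / 2 + s / 2 ^ (n + 1)) * order k) =
        Real.exp (σ * order k) * Real.exp ((s / 2 + 3 * σ) * order k) := by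
      rw [e1, ← Real.exp_add]; ring_nf
    rw [e, ← mul_assoc]
    refine mul_le_mul_of_nonneg_right ?_ (Real.exp_nonneg _)
    calc 3 * (2 ^ n * (1 + order k) ^ T) ^ 2 = 3 * ((2 ^ n) ^ 2 * (1 + order k) ^ (2 * T)) := by
          rw [mul_pow, ← pow_mul (1 + order k), mul_comm T]
      _ ≤ 3 * ((2 ^ n) ^ 2 * (D * (2 ^ n) ^ (2 * T) * Real.exp (σ * order k))) := by
        gcongr; exact key k
      _ = 3 * (D * (4 ^ (T + 1)) ^ n * Real.exp (σ * order k)) := by rw [h4]; ring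
      _ ≤ (3 + A) * (D * (4 ^ (T + 1)) ^ n * Real.exp (σ * order k)) := by gcongr; linarith
      _ = _ := by ring
  · have e : Real.exp ((s / 2 + 3 * σ) * order k) =
        Real.exp (σ * order k) * Real.exp ((s / 2 + s / 2 ^ (n + 2)) * order k) := by
      rw [e2, ← Real.exp_add]; ring_nf
    rw [e, ← mul_assoc]
    refine le_mul_of_one_le_left (Real.exp_nonneg _) ((hω k hk).trans ?_)
    have h1 : (1 + order k) ^ T ≤ (1 + order k) ^ (2 * T) :=
      pow_le_pow_right₀ (by linarith [order_nonneg k]) (by omega)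
    calc A * (1 + order k) ^ T * |freq ω k|
        ≤ A * (D * (2 ^ n) ^ (2 * T) * Real.exp (σ * order k)) * |freq ω k| := by
          gcongr; exact h1.trans (key k)
      _ ≤ (3 + A) * (D * ((2 ^ n) ^ 2 * (2 ^ n) ^ (2 * T)) * Real.exp (σ * order k)) *
          |freq ω k| := by
        gcongr
        · linarith
        · exact le_mul_of_one_le_left (by positivity)
            (one_le_pow₀ (one_le_pow₀ (by norm_num)))
      _ = _ := by rw [h4]; ring

/-- The state of the iteration after `n` steps: the set of remaining parameters, the frequency,
and the off-diagonal term. -/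
structure StepState where
  /-- the remaining parameters -/
  params : Set ℝ
  /-- the constant diagonal term, as a function of the parameter -/
  rot : ℝ → ℝ
  /-- the off-diagonal term, as a function of the parameter and of time -/
  off : ℝ → ℝ → ℂ

/-- The bounds kept by the iteration, which starts at `S₀`. The frequency stays close to
`-√x` in the Lipschitz sense, the off-diagonal term decays geometrically, and growth bounds
are passed back to `S₀` with a uniformly bounded factor. -/
structure StepState.Good {r : ℕ} (ω : Fin r → ℝ) (s δ θ Λ : ℝ) (S₀ : StepState) (n : ℕ)
    (S : StepState) : Prop where
  subset : S.params ⊆ S₀.params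
  lip : LipBound S.params (1 / 5 - 1 / 10 * (1 / 2) ^ n) (fun x => (S.rot x + √x : ℂ))
  bound : QPBound ω S.params (s / 2 + s / 2 ^ (n + 1)) (δ * θ ^ n) S.off
  growth : ∀ x ∈ S.params, ∀ C γ, 0 ≤ C →
    GrowthBound C γ (fun _ => Λ * S.rot x) (fun t => Λ * S.off x t) →
    GrowthBound (C * Real.exp (2 - 2 * (1 / 2) ^ n)) γ (fun _ => Λ * S₀.rot x)
      (fun t => Λ * S₀.off x t)

lemma abs_sqrt_sub_sqrt_bounds {x y : ℝ} (hx : x ∈ Set.Icc (1 : ℝ) 2)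
    (hy : y ∈ Set.Icc (1 : ℝ) 2) :
    |x - y| / 3 ≤ |√x - √y| ∧ |√x - √y| ≤ |x - y| / 2 := by
  have hx1 : 1 ≤ √x := Real.one_le_sqrt.2 hx.1
  have hy1 : 1 ≤ √y := Real.one_le_sqrt.2 hy.1
  have hx2 : √x ≤ 3 / 2 := Real.sqrt_le_iff.2 ⟨by norm_num, by linarith [hx.2]⟩
  have hy2 : √y ≤ 3 / 2 := Real.sqrt_le_iff.2 ⟨by norm_num, by linarith [hy.2]⟩
  have e : |x - y| = |√x - √y| * (√x + √y) := by
    rw [← abs_of_nonneg (by positivity : 0 ≤ √x + √y), ← abs_mul]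
    congr 1
    have := Real.sq_sqrt (by linarith [hx.1] : 0 ≤ x)
    have := Real.sq_sqrt (by linarith [hy.1] : 0 ≤ y)
    nlinarith
  rw [e]
  have := abs_nonneg (√x - √y)
  constructor <;> nlinarith

/-- Consequences of the closeness of the frequency to `-√x`. -/
lemma LipBound.rot_bounds {m : ℝ} (hE : E ⊆ Set.Icc 1 2)
    (h : LipBound E m (fun x => (ℓ x + √x : ℂ))) (hm : m ≤ 1 / 5) :
    (∀ x ∈ E, 4 / 5 ≤ |ℓ x| ∧ |ℓ x| ≤ 2) ∧
    ∀ x ∈ E, ∀ y ∈ E, |x - y| / 10 ≤ |ℓ x - ℓ y| ∧ |ℓ x - ℓ y| ≤ |x - y| := by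
  have hn : ∀ x ∈ E, |ℓ x + √x| ≤ 1 / 5 := fun x hx => by
    have := h.2.1 x hx
    simp only [← Complex.ofReal_add, Complex.norm_real] at this
    exact this.trans hm
  refine ⟨fun x hx => ?_, fun x hx y hy => ?_⟩
  · have h1 := abs_le.1 (hn x hx)
    have hx1 : 1 ≤ √x := Real.one_le_sqrt.2 (hE hx).1
    have hx2 : √x ≤ 3 / 2 := Real.sqrt_le_iff.2 ⟨by norm_num, by linarith [(hE hx).2]⟩
    rw [abs_of_neg (by linarith)]
    constructor <;> linarith
  · obtain ⟨h1, h2⟩ := abs_sqrt_sub_sqrt_bounds (hE hx) (hE hy)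
    have h3 : |(ℓ x + √x) - (ℓ y + √y)| ≤ 1 / 5 * |x - y| := by
      have h4 := h.2.2 x hx y hy
      simp only [← Complex.ofReal_add, ← Complex.ofReal_sub, Complex.norm_real,
        Real.norm_eq_abs] at h4
      have h5 : 0 ≤ |ℓ x + √x| * |x - y| := by positivity
      have h6 := mul_le_mul_of_nonneg_right hm (abs_nonneg (x - y))
      linarith
    have h7 : |√x - √y| ≤ |(ℓ x + √x) - (ℓ y + √y)| + |ℓ x - ℓ y| := by
      calc |√x - √y| = |(ℓ x + √x) - (ℓ y + √y) - (ℓ x - ℓ y)| := by congr 1; ring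
        _ ≤ _ := abs_sub _ _
    have h8 : |ℓ x - ℓ y| ≤ |(ℓ x + √x) - (ℓ y + √y)| + |√x - √y| := by
      calc |ℓ x - ℓ y| = |(ℓ x + √x) - (ℓ y + √y) - (√x - √y)| := by congr 1; ring
        _ ≤ _ := abs_sub _ _
    have := abs_nonneg (x - y)
    constructor <;> linarith

/-- The iteration converges: if the off-diagonal term is small enough, a good sequence of states
exists, and the parameters that survive all steps have bounded solutions. -/
lemma exists_iteration {T : ℕ} {A : ℝ} (hA : 0 ≤ A)
    (hω : ∀ k : Fin r → ℤ, k ≠ 0 → 1 ≤ A * (1 + order k) ^ T * |freq ω k|) (hs : 0 < s) :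
    ∃ δ > 0, ∀ (Λ : ℝ) (S₀ : StepState), 0 < Λ → Λ ≤ 1 → S₀.params ⊆ Set.Icc 1 2 →
      LipBound S₀.params (1 / 10) (fun x => (S₀.rot x + √x : ℂ)) →
      QPBound ω S₀.params s δ S₀.off →
      ∃ S : ℕ → StepState, (S 0).params = S₀.params ∧
        (∀ n, (S (n + 1)).params = nonresonant ω T Λ n (S n).params (S n).rot) ∧
        (∀ n, (S n).params ⊆ Set.Icc 1 2 ∧
          LipBound (S n).params (1 / 5) (fun x => ((S n).rot x + √x : ℂ))) ∧
        ∀ x ∈ ⋂ n, (S n).params, GrowthBound (Real.exp 2) 0 (fun _ => Λ * S₀.rot x)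
          (fun t => Λ * S₀.off x t) := by
  obtain ⟨K₀, B, hK₀, hB, hloss⟩ := exists_geometric_loss hA hω hs
  have hB0 : 0 < B := zero_lt_one.trans_le hB
  -- the off-diagonal terms `δ θⁿ` beat the losses `K₀ Bⁿ` by the factor `2⁻ⁿ`, which makes the
  -- transformations summable; the cubic gain is what allows any fixed ratio `θ`
  set θ : ℝ := 1 / (2 * B) with hθ
  have hθ0 : 0 < θ := by positivity
  have hBθ : B * θ = 1 / 2 := by rw [hθ]; field_simp
  have hθ1 : θ ≤ 1 / 2 := by nlinarith
  set δ : ℝ := min (1 / 10) (min (1 / (4 * K₀)) (θ / (4 * K₀))) with hδ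
  have hδ0 : 0 < δ := by positivity
  have hδ1 : δ ≤ 1 / 10 := min_le_left _ _
  have hδ2 : K₀ * δ ≤ 1 / 4 := by
    have : δ ≤ 1 / (4 * K₀) := (min_le_right _ _).trans (min_le_left _ _)
    rw [le_div_iff₀ (by positivity)] at this; linarith
  have hδ3 : 4 * (K₀ * δ) ≤ θ := by
    have : δ ≤ θ / (4 * K₀) := (min_le_right _ _).trans (min_le_right _ _)
    rw [le_div_iff₀ (by positivity)] at this; linarith
  refine ⟨δ, hδ0, fun Λ S₀ hΛ hΛ1 hE₀ hlip₀ hQ₀ => ?_⟩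
  have hbase : S₀.Good ω s δ θ Λ 0 S₀ := by
    refine ⟨le_rfl, hlip₀.mono le_rfl (by norm_num), hQ₀.mono le_rfl (by linarith) (by simp),
      fun x _ C γ _ h => by simpa using h⟩
  have hstep : ∀ n S, S₀.Good ω s δ θ Λ n S →
      ∃ S', S'.params = nonresonant ω T Λ n S.params S.rot ∧ S₀.Good ω s δ θ Λ (n + 1) S' := by
    intro n S hS
    obtain ⟨s₁, h1, h2, h3, h4⟩ := hloss n
    have h2n : (0 : ℝ) < (1 / 2) ^ n := by positivity
    have h2n1 : ((1 : ℝ) / 2) ^ n ≤ 1 := pow_le_one₀ (by norm_num) (by norm_num)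
    -- the size of the `n`-th transformation
    have hη : K₀ * B ^ n * (δ * θ ^ n) = K₀ * δ * (1 / 2) ^ n := by
      rw [← hBθ, mul_pow]; ring
    have hη0 : 0 ≤ K₀ * δ * (1 / 2) ^ n := by positivity
    have hη4 : K₀ * δ * (1 / 2) ^ n ≤ 1 / 4 * (1 / 2) ^ n := by gcongr
    have hθn : θ ^ n ≤ 1 := pow_le_one₀ hθ0.le (by linarith)
    have hm : 1 / 5 - 1 / 10 * (1 / 2 : ℝ) ^ n ≤ 1 / 5 := by linarith
    have hrot := hS.lip.rot_bounds (hS.subset.trans hE₀) hm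
    obtain ⟨ℓ', Q', hl, hq, hg⟩ := exists_step hS.bound (by positivity) h1 h2 hΛ hΛ1
      (fun x hx y hy => (hrot.2 x hx y hy).2) (by positivity) h3 h4
      (by rw [hη]; linarith)
    rw [hη] at hl hq hg
    refine ⟨⟨_, ℓ', Q'⟩, rfl, nonresonant_subset.trans hS.subset, ?_, ?_, ?_⟩
    · refine ((hl.add (hS.lip.mono nonresonant_subset le_rfl)).congr fun x _ => ?_).mono le_rfl ?_
      · ring
      · have : δ * θ ^ n ≤ 1 / 10 := by nlinarith
        have : K₀ * δ * (1 / 2) ^ n * (δ * θ ^ n) ≤ 1 / 4 * (1 / 2) ^ n * (1 / 10) := by gcongr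
        rw [pow_succ]; linarith
    · refine hq.mono le_rfl le_rfl ?_
      have h5 : 4 * (K₀ * δ * (1 / 2) ^ n) ^ 2 ≤ θ := by
        have : (K₀ * δ * (1 / 2) ^ n) ^ 2 ≤ (K₀ * δ) * 1 := by
          rw [pow_two]
          refine mul_le_mul ?_ (by linarith) hη0 (by positivity)
          exact mul_le_of_le_one_right (by positivity) h2n1
        linarith
      calc _ ≤ θ * (δ * θ ^ n) := by gcongr
        _ = _ := by ring
    · intro x hx C γ hC h
      have hf : (1 + K₀ * δ * (1 / 2) ^ n) / (1 - K₀ * δ * (1 / 2) ^ n) ≤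
          Real.exp ((1 / 2) ^ n) := by
        rw [div_le_iff₀ (by linarith)]
        have h6 := Real.add_one_le_exp (((1 : ℝ) / 2) ^ n)
        calc _ ≤ ((1 / 2) ^ n + 1) * (1 - K₀ * δ * (1 / 2) ^ n) := by nlinarith
          _ ≤ _ := by gcongr; linarith
      have hf0 : 0 ≤ (1 + K₀ * δ * (1 / 2) ^ n) / (1 - K₀ * δ * (1 / 2) ^ n) :=
        div_nonneg (by linarith) (by linarith)
      have h7 := hS.growth x hx.1 _ γ (mul_nonneg hC hf0) (hg x hx C γ hC h)
      intro t₀ T u hu t ht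
      refine (h7 t₀ T u hu t ht).trans ?_
      have h8 : C * ((1 + K₀ * δ * (1 / 2) ^ n) / (1 - K₀ * δ * (1 / 2) ^ n)) *
          Real.exp (2 - 2 * (1 / 2) ^ n) ≤ C * Real.exp (2 - 2 * (1 / 2) ^ (n + 1)) := by
        rw [mul_assoc]
        refine mul_le_mul_of_nonneg_left ?_ hC
        calc _ ≤ Real.exp ((1 / 2) ^ n) * Real.exp (2 - 2 * (1 / 2) ^ n) := by gcongr
          _ = _ := by rw [← Real.exp_add, pow_succ]; ring_nf
      gcongr
  choose next hnext hgood using hstep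
  let seq : ∀ n, {S // S₀.Good ω s δ θ Λ n S} := fun n =>
    Nat.rec ⟨S₀, hbase⟩ (fun n S => ⟨next n S.1 S.2, hgood n S.1 S.2⟩) n
  refine ⟨fun n => (seq n).1, rfl, fun n => hnext n _ _, fun n => ⟨(seq n).2.subset.trans hE₀, ?_⟩,
    fun x hx => ?_⟩
  · refine (seq n).2.lip.mono le_rfl ?_
    have : (0 : ℝ) < (1 / 2) ^ n := by positivity
    linarith
  · -- after `n` steps the growth rate is `Λ δ θⁿ`, and the bound passes to the limit
    rw [Set.mem_iInter] at hx
    intro t₀ T u hu t ht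
    have hn : ∀ n : ℕ, ‖u t‖ ≤ Real.exp 2 * Real.exp (Λ * (δ * θ ^ n) * (t - t₀)) * ‖u t₀‖ := by
      intro n
      have h1 : GrowthBound 1 (Λ * (δ * θ ^ n)) (fun _ => Λ * (seq n).1.rot x)
          (fun t => Λ * (seq n).1.off x t) := GrowthBound.of_norm_le fun t => by
        rw [norm_mul, Complex.norm_real, Real.norm_eq_abs, abs_of_pos hΛ]
        exact mul_le_mul_of_nonneg_left ((seq n).2.bound.norm_le (by positivity) (hx n) t) hΛ.le
      refine ((seq n).2.growth x (hx n) 1 _ zero_le_one h1 t₀ T u hu t ht).trans ?_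
      rw [one_mul]
      have : (0 : ℝ) < (1 / 2) ^ n := by positivity
      gcongr
      linarith
    have hlim : Tendsto (fun n : ℕ => Real.exp 2 * Real.exp (Λ * (δ * θ ^ n) * (t - t₀)) * ‖u t₀‖)
        atTop (𝓝 (Real.exp 2 * Real.exp (Λ * (δ * 0) * (t - t₀)) * ‖u t₀‖)) := by
      have h0 := tendsto_pow_atTop_nhds_zero_of_lt_one hθ0.le (by linarith : θ < 1)
      exact (((Real.continuous_exp.tendsto _).comp
        (((h0.const_mul δ).const_mul Λ).mul_const (t - t₀))).const_mul _).mul_const _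
    have := ge_of_tendsto' hlim hn
    simpa using this

end Iteration

section Measure

/-! ### Measure of the resonant parameters -/

variable {r : ℕ} {ω : Fin r → ℝ}

lemma summable_prod_pi {g : ℤ → ℝ} (hg0 : ∀ n, 0 ≤ g n) (hg : Summable g) :
    ∀ r : ℕ, Summable fun k : Fin r → ℤ => ∏ j, g (k j)
  | 0 => (hasSum_fintype _).summable
  | r + 1 => by
    have h := hg.mul_of_nonneg (summable_prod_pi hg0 hg r) hg0
      fun k => Finset.prod_nonneg fun j _ => hg0 _
    rw [← (Fin.consEquiv fun _ : Fin (r + 1) => ℤ).summable_iff]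
    refine h.congr fun p => ?_
    simp [Fin.prod_univ_succ]

lemma summable_inv_order_pow {T : ℕ} (hT : 2 * r ≤ T) :
    Summable fun k : Fin r → ℤ => ((1 + order k) ^ T)⁻¹ := by
  have h1 : Summable fun n : ℤ => ((1 + |(n : ℝ)|) ^ 2)⁻¹ := by
    have h := (Real.summable_one_div_int_pow (p := 2)).2 (by norm_num)
    refine Summable.of_norm_bounded_eventually h ?_
    refine (Set.finite_singleton (0 : ℤ)).subset fun n hn => ?_
    by_contra h0
    refine hn ?_
    have h0' : (n : ℝ) ≠ 0 := by exact_mod_cast h0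
    have : 0 < |(n : ℝ)| := abs_pos.2 h0'
    change ‖((1 + |(n : ℝ)|) ^ 2)⁻¹‖ ≤ 1 / (n : ℝ) ^ 2
    rw [Real.norm_of_nonneg (by positivity), one_div, ← sq_abs (n : ℝ)]
    gcongr
    linarith
  refine Summable.of_nonneg_of_le (fun k => ?_) (fun k => ?_)
    (summable_prod_pi (fun n => by positivity) h1 r)
  · have := order_nonneg k; positivity
  · have hk := order_nonneg k
    rw [Finset.prod_inv_distrib]
    have h2 : ∏ j, (1 + |(k j : ℝ)|) ^ 2 ≤ ∏ _j : Fin r, (1 + order k) ^ 2 := by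
      refine Finset.prod_le_prod (fun j _ => by positivity) fun j _ => ?_
      have : |(k j : ℝ)| ≤ order k :=
        Finset.single_le_sum (f := fun j => |(k j : ℝ)|) (fun _ _ => abs_nonneg _)
          (Finset.mem_univ j)
      gcongr
    rw [Finset.prod_const, Finset.card_univ, Fintype.card_fin, ← pow_mul] at h2
    have h3 : (1 + order k) ^ (2 * r) ≤ (1 + order k) ^ T := pow_le_pow_right₀ (by linarith) hT
    have h4 : 0 < ∏ j, (1 + |(k j : ℝ)|) ^ 2 := Finset.prod_pos fun j _ => by positivity
    exact inv_anti₀ h4 (h2.trans h3)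

open Classical in
/-- The weighted number of frequencies of size less than `5Λ`: the only ones that `2Λℓ` with
`|ℓ| ≤ 2` can come close to. -/
noncomputable def smallDivisorSum (ω : Fin r → ℝ) (T : ℕ) (Λ : ℝ) : ℝ :=
  ∑' k : Fin r → ℤ, if k ≠ 0 ∧ |freq ω k| < 5 * Λ then ((1 + order k) ^ T)⁻¹ else 0

lemma tendsto_smallDivisorSum {T : ℕ} (hT : 2 * r ≤ T) (hω : ∀ k ≠ 0, freq ω k ≠ 0) :
    Tendsto (smallDivisorSum ω T) (𝓝[>] 0) (𝓝 0) := by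
  classical
  have h : Tendsto (smallDivisorSum ω T) (𝓝[>] 0) (𝓝 (∑' _ : Fin r → ℤ, (0 : ℝ))) := by
    refine tendsto_tsum_of_dominated_convergence (summable_inv_order_pow hT) (fun k => ?_)
      (Eventually.of_forall fun Λ k => ?_)
    · refine tendsto_const_nhds.congr' ?_
      by_cases hk : k = 0
      · simp [hk]
      · have hpos : 0 < |freq ω k| / 5 := div_pos (abs_pos.2 (hω k hk)) (by norm_num)
        filter_upwards [nhdsWithin_le_nhds (gt_mem_nhds hpos)] with Λ hΛ
        rw [if_neg]
        rintro ⟨-, h⟩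
        linarith
    · have := order_nonneg k
      split_ifs
      · rw [Real.norm_of_nonneg (by positivity)]
      · rw [norm_zero]; positivity
  simpa using h

lemma volume_diff_nonresonant_le {E : Set ℝ} {ℓ : ℝ → ℝ} {T n : ℕ} {Λ : ℝ} (hT : 2 * r ≤ T)
    (hΛ : 0 < Λ) (hE : E ⊆ Set.Icc 1 2) (hℓ : LipBound E (1 / 5) (fun x => (ℓ x + √x : ℂ))) :
    volume (E \ nonresonant ω T Λ n E ℓ) ≤
      ENNReal.ofReal (10 * (1 / 2) ^ n * smallDivisorSum ω T Λ) := by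
  classical
  obtain ⟨hb, hl⟩ := hℓ.rot_bounds hE le_rfl
  have hd1 : ∀ k : Fin r → ℤ, ((2 : ℝ) ^ n * (1 + order k) ^ T)⁻¹ ≤ 1 := fun k =>
    inv_le_one_of_one_le₀ (one_le_mul_of_one_le_of_one_le (one_le_pow₀ (by norm_num))
      (one_le_pow₀ (by linarith [order_nonneg k])))
  set R : (Fin r → ℤ) → Set ℝ := fun k =>
    {x ∈ E | |freq ω k - 2 * Λ * ℓ x| < Λ * (2 ^ n * (1 + order k) ^ T)⁻¹} with hR
  set g : (Fin r → ℤ) → ℝ := fun k =>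
    if k ≠ 0 ∧ |freq ω k| < 5 * Λ then ((1 + order k) ^ T)⁻¹ else 0 with hg
  have hg0 : ∀ k, 0 ≤ g k := fun k => by
    have := order_nonneg k
    simp only [hg]; split_ifs <;> positivity
  have hgs : Summable g := Summable.of_nonneg_of_le hg0 (fun k => by
    have := order_nonneg k
    simp only [hg]
    split_ifs
    · exact le_rfl
    · positivity) (summable_inv_order_pow hT)
  have hsub : E \ nonresonant ω T Λ n E ℓ ⊆ ⋃ k, R k := by
    rintro x ⟨hx, hx'⟩
    by_contra hcon
    refine hx' ⟨hx, fun k => ?_⟩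
    by_contra hk
    exact hcon (Set.mem_iUnion.2 ⟨k, hx, not_le.1 hk⟩)
  have hvol : ∀ k, volume (R k) ≤ ENNReal.ofReal (10 * (1 / 2) ^ n * g k) := by
    intro k
    by_cases hk : k ≠ 0 ∧ |freq ω k| < 5 * Λ
    · -- `ℓ` contracts distances at most by the factor `10`, so `R k` has a small diameter
      refine (Real.volume_le_diam _).trans (Metric.ediam_le fun x hx y hy => ?_)
      rw [edist_dist, Real.dist_eq]
      refine ENNReal.ofReal_le_ofReal ?_
      have h1 := (hl x hx.1 y hy.1).1
      have h2 : 2 * Λ * |ℓ x - ℓ y| ≤ 2 * (Λ * (2 ^ n * (1 + order k) ^ T)⁻¹) := by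
        have h3 := abs_sub (freq ω k - 2 * Λ * ℓ y) (freq ω k - 2 * Λ * ℓ x)
        have e : freq ω k - 2 * Λ * ℓ y - (freq ω k - 2 * Λ * ℓ x) = 2 * Λ * (ℓ x - ℓ y) := by
          ring
        rw [e, abs_mul, abs_of_pos (by positivity : 0 < 2 * Λ)] at h3
        linarith [hx.2, hy.2]
      have h4 : |ℓ x - ℓ y| ≤ (2 ^ n * (1 + order k) ^ T)⁻¹ := by
        refine le_of_mul_le_mul_left ?_ (by positivity : 0 < 2 * Λ)
        linarith
      simp only [hg, if_pos hk]
      rw [mul_inv, ← inv_pow] at h4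
      rw [one_div]
      linarith
    · -- otherwise `2Λℓ`, of size between `8Λ/5` and `4Λ`, is not close to `⟨k, ω⟩`
      have hempty : R k = ∅ := by
        refine Set.eq_empty_of_forall_notMem fun x hx => hk ?_
        have h1 := hx.2
        have h2 := hb x hx.1
        have h3 : Λ * (2 ^ n * (1 + order k) ^ T)⁻¹ ≤ Λ * 1 := by gcongr; exact hd1 k
        have e : |2 * Λ * ℓ x| = 2 * Λ * |ℓ x| := by
          rw [abs_mul, abs_of_pos (by positivity : 0 < 2 * Λ)]
        constructor
        · rintro rfl
          rw [freq_zero, zero_sub, abs_neg, e] at h1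
          nlinarith
        · have h4 := abs_sub_abs_le_abs_sub (freq ω k) (2 * Λ * ℓ x)
          rw [e] at h4
          nlinarith
      rw [hempty, measure_empty]; exact zero_le
  calc volume (E \ nonresonant ω T Λ n E ℓ) ≤ ∑' k, volume (R k) :=
        (measure_mono hsub).trans (measure_iUnion_le R)
    _ ≤ ∑' k, ENNReal.ofReal (10 * (1 / 2) ^ n * g k) := ENNReal.tsum_le_tsum hvol
    _ = ENNReal.ofReal (∑' k, 10 * (1 / 2) ^ n * g k) :=
        (ENNReal.ofReal_tsum_of_nonneg (fun k => by have := hg0 k; positivity)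
          (hgs.mul_left _)).symm
    _ = _ := by rw [tsum_mul_left]; rfl

lemma volume_diff_iInter_nonresonant_le {T : ℕ} {Λ : ℝ} (hT : 2 * r ≤ T) (hΛ : 0 < Λ)
    {S : ℕ → StepState}
    (hS : ∀ n, (S (n + 1)).params = nonresonant ω T Λ n (S n).params (S n).rot)
    (hl : ∀ n, (S n).params ⊆ Set.Icc 1 2 ∧
      LipBound (S n).params (1 / 5) (fun x => ((S n).rot x + √x : ℂ))) :
    volume ((S 0).params \ ⋂ n, (S n).params) ≤ ENNReal.ofReal (20 * smallDivisorSum ω T Λ) := by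
  have hσ : 0 ≤ smallDivisorSum ω T Λ := tsum_nonneg fun k => by
    have := order_nonneg k
    split_ifs <;> positivity
  have hsub : (S 0).params \ ⋂ n, (S n).params ⊆ ⋃ n, (S n).params \ (S (n + 1)).params := by
    rintro x ⟨hx, hx'⟩
    by_contra hcon
    refine hx' (Set.mem_iInter.2 fun n => ?_)
    induction n with
    | zero => exact hx
    | succ n ih =>
      by_contra h
      exact hcon (Set.mem_iUnion.2 ⟨n, ih, h⟩)
  have hgeo : HasSum (fun n : ℕ => 10 * (1 / 2 : ℝ) ^ n * smallDivisorSum ω T Λ)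
      (20 * smallDivisorSum ω T Λ) := by
    have := (hasSum_geometric_two.mul_left 10).mul_right (smallDivisorSum ω T Λ)
    rwa [show (10 : ℝ) * 2 = 20 by norm_num] at this
  calc _ ≤ ∑' n, volume ((S n).params \ (S (n + 1)).params) :=
        (measure_mono hsub).trans (measure_iUnion_le _)
    _ ≤ ∑' n, ENNReal.ofReal (10 * (1 / 2 : ℝ) ^ n * smallDivisorSum ω T Λ) :=
        ENNReal.tsum_le_tsum fun n => by
          rw [hS n]; exact volume_diff_nonresonant_le hT hΛ (hl n).1 (hl n).2
    _ = _ := by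
        rw [← ENNReal.ofReal_tsum_of_nonneg (fun n => by positivity) hgeo.summable, hgeo.tsum_eq]

end Measure

/-! ### Fourier expansion of analytic quasi-periodic functions -/

section Fourier

variable {r : ℕ} {ρ : ℝ} {F : (Fin r → ℂ) → ℂ}

lemma add_mem_complexStrip {θ v : Fin r → ℂ} (hθ : θ ∈ complexStrip r ρ)
    (hv : ∀ j, (v j).im = 0) : θ + v ∈ complexStrip r ρ := fun j => by
  simpa [hv j] using hθ j

lemma periodic_int
    (hp : ∀ θ ∈ complexStrip r ρ, ∀ j : Fin r,
      F (θ + Pi.single j ((2 * Real.pi : ℝ) : ℂ)) = F θ)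
    {θ : Fin r → ℂ} (hθ : θ ∈ complexStrip r ρ) (n : Fin r → ℤ) :
    F (θ + fun j => ((2 * Real.pi * n j : ℝ) : ℂ)) = F θ := by
  -- the real periods form a subgroup, so it is enough that it contains the generators
  let P : AddSubgroup (Fin r → ℂ) :=
    { carrier := {v | (∀ j, (v j).im = 0) ∧ ∀ θ ∈ complexStrip r ρ, F (θ + v) = F θ}
      zero_mem' := ⟨fun j => rfl, fun θ _ => by rw [add_zero]⟩
      add_mem' := fun {v w} hv hw => ⟨fun j => by simp [hv.1 j, hw.1 j], fun θ hθ => by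
        rw [← add_assoc, hw.2 _ (add_mem_complexStrip hθ hv.1), hv.2 _ hθ]⟩
      neg_mem' := fun {v} hv => by
        have him : ∀ j, ((-v) j).im = 0 := fun j => by simp [hv.1 j]
        refine ⟨him, fun θ hθ => ?_⟩
        rw [← hv.2 _ (add_mem_complexStrip hθ him), neg_add_cancel_right] }
  have hgen : ∀ j : Fin r, (Pi.single j ((2 * Real.pi : ℝ) : ℂ) : Fin r → ℂ) ∈ P := fun j =>
    ⟨fun i => by
      by_cases h : i = j
      · subst h; simp
      · simp [h], fun θ hθ => hp θ hθ j⟩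
  have hsum : (fun j => ((2 * Real.pi * n j : ℝ) : ℂ)) =
      ∑ j, n j • (Pi.single j ((2 * Real.pi : ℝ) : ℂ) : Fin r → ℂ) := by
    funext i
    rw [Finset.sum_apply, Finset.sum_eq_single i]
    · simp; ring
    · intro j _ hj
      simp [Ne.symm hj]
    · simp
  have hmem : (fun j => ((2 * Real.pi * n j : ℝ) : ℂ)) ∈ P := by
    rw [hsum]; exact P.sum_mem fun j _ => P.zsmul_mem (hgen j) _
  exact hmem.2 θ hθ

lemma exists_bound_of_periodic (hF : AnalyticOnNhd ℂ F (complexStrip r ρ))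
    (hp : ∀ θ ∈ complexStrip r ρ, ∀ j : Fin r,
      F (θ + Pi.single j ((2 * Real.pi : ℝ) : ℂ)) = F θ) :
    ∃ M, ∀ θ ∈ complexStrip r ρ, ‖F θ‖ ≤ M := by
  set k : Set (Fin r → ℂ) :=
    Set.pi Set.univ fun _ => Set.Icc 0 (2 * Real.pi) ×ℂ Set.Icc (-ρ) ρ with hk
  have hkc : IsCompact k := isCompact_univ_pi fun _ => isCompact_Icc.reProdIm isCompact_Icc
  have hks : k ⊆ complexStrip r ρ := fun θ hθ j => abs_le.2 (hθ j trivial).2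
  obtain ⟨M, hM⟩ := hkc.exists_bound_of_continuousOn (hF.continuousOn.mono hks)
  refine ⟨M, fun θ hθ => ?_⟩
  have h2π : (0 : ℝ) < 2 * Real.pi := Real.two_pi_pos
  rw [← periodic_int hp hθ fun j => -⌊(θ j).re / (2 * Real.pi)⌋]
  refine hM _ fun j _ => ⟨?_, ?_⟩
  · have h1 := Int.floor_le ((θ j).re / (2 * Real.pi))
    have h2 := Int.lt_floor_add_one ((θ j).re / (2 * Real.pi))
    rw [le_div_iff₀ h2π] at h1
    rw [div_lt_iff₀ h2π] at h2
    simp only [Set.mem_preimage, Pi.add_apply, Complex.add_re, Complex.ofReal_re, Set.mem_Icc]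
    push_cast
    constructor <;> linarith
  · have := abs_le.1 (hθ j)
    simpa using this

/-- Shift of the contour for a periodic function that is analytic in a strip. -/
lemma integral_shift {H : ℂ → ℂ} (hd : ∀ z : ℂ, |z.im| ≤ ρ → DifferentiableAt ℂ H z)
    (hp : ∀ z : ℂ, |z.im| ≤ ρ → H (z + (2 * Real.pi : ℝ)) = H z) {y : ℝ} (hy : |y| ≤ ρ) :
    ∫ x : ℝ in (0 : ℝ)..2 * Real.pi, H x =
      ∫ x : ℝ in (0 : ℝ)..2 * Real.pi, H (x + y * Complex.I) := by
  have him : ∀ z ∈ (Set.uIcc (0 : ℂ).re ((2 * Real.pi : ℝ) + y * Complex.I : ℂ).re ×ℂ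
      Set.uIcc (0 : ℂ).im ((2 * Real.pi : ℝ) + y * Complex.I : ℂ).im), |z.im| ≤ ρ := by
    intro z hz
    have h1 : z.im ∈ Set.uIcc 0 y := by simpa using hz.2
    have h2 := Set.abs_sub_left_of_mem_uIcc h1
    simp only [sub_zero] at h2
    exact h2.trans hy
  have h := Complex.integral_boundary_rect_eq_zero_of_differentiableOn H 0
    ((2 * Real.pi : ℝ) + y * Complex.I) fun z hz => (hd z (him z hz)).differentiableWithinAt
  have hside : ∫ v : ℝ in (0 : ℝ)..y, H ((2 * Real.pi : ℝ) + v * Complex.I) =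
      ∫ v : ℝ in (0 : ℝ)..y, H (v * Complex.I) := by
    refine intervalIntegral.integral_congr fun v hv => ?_
    have h2 := Set.abs_sub_left_of_mem_uIcc hv
    simp only [sub_zero] at h2
    have := hp (v * Complex.I) (by simpa using h2.trans hy)
    rw [← this, add_comm]
  simp only [Complex.zero_re, Complex.zero_im, Complex.add_re, Complex.add_im, Complex.ofReal_re,
    Complex.ofReal_im, Complex.mul_re, Complex.mul_im, Complex.I_re, Complex.I_im, mul_zero,
    mul_one, sub_zero, add_zero, zero_add, Complex.ofReal_zero, zero_mul] at h
  rw [hside, add_sub_cancel_right] at h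
  exact sub_eq_zero.1 h

/-- Restriction to the real torus, as a continuous function on `(ℝ/ℤ)^r`. -/
lemma exists_torus_function (hρ : 0 ≤ ρ) (hF : AnalyticOnNhd ℂ F (complexStrip r ρ))
    (hp : ∀ θ ∈ complexStrip r ρ, ∀ j : Fin r,
      F (θ + Pi.single j ((2 * Real.pi : ℝ) : ℂ)) = F θ) :
    ∃ f : C(UnitAddTorus (Fin r), ℂ), ∀ x : Fin r → ℝ,
      f (fun j => (x j : UnitAddCircle)) = F fun j => ((2 * Real.pi * x j : ℝ) : ℂ) := by
  have hmem : ∀ x : Fin r → ℝ, (fun j => ((2 * Real.pi * x j : ℝ) : ℂ)) ∈ complexStrip r ρ :=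
    fun x j => by simpa using hρ
  have hq : IsOpenQuotientMap
      (Pi.map fun (_ : Fin r) (x : ℝ) => (x : UnitAddCircle)) :=
    IsOpenQuotientMap.piMap fun _ => QuotientAddGroup.isOpenQuotientMap_mk
  let π : C(Fin r → ℝ, UnitAddTorus (Fin r)) := ⟨_, hq.continuous⟩
  let g : C(Fin r → ℝ, ℂ) := ⟨fun x => F fun j => ((2 * Real.pi * x j : ℝ) : ℂ),
    hF.continuousOn.comp_continuous (by fun_prop) hmem⟩
  have hπ : IsQuotientMap π := hq.isQuotientMap
  have hfac : Function.FactorsThrough g π := by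
    intro x y hxy
    have hz : ∀ j, ∃ n : ℤ, n • (1 : ℝ) = -x j + y j := fun j => by
      have : ((x j : ℝ) : UnitAddCircle) = y j := congrFun hxy j
      exact AddSubgroup.mem_zmultiples_iff.1 (QuotientAddGroup.eq.1 this)
    choose n hn using hz
    have e : (fun j => ((2 * Real.pi * y j : ℝ) : ℂ)) =
        (fun j => ((2 * Real.pi * x j : ℝ) : ℂ)) + fun j => ((2 * Real.pi * n j : ℝ) : ℂ) := by
      funext j
      have h1 : y j = x j + n j := by
        have := hn j
        simp only [zsmul_eq_mul, mul_one] at this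
        linarith
      rw [Pi.add_apply, h1]; push_cast; ring
    change F _ = F _
    rw [e, periodic_int hp (hmem x) n]
  refine ⟨hπ.lift g hfac, fun x => ?_⟩
  exact DFunLike.congr_fun (hπ.lift_comp g hfac) x

/-- The Fourier coefficients decay exponentially in each index. The coefficient is averaged over
all translates of the fundamental cube in the direction `j`, which isolates the integral over the
`j`-th angle without splitting off a coordinate; the contour of that integral is then shifted. -/
lemma norm_mFourierCoeff_le (hρ : 0 ≤ ρ) (hF : AnalyticOnNhd ℂ F (complexStrip r ρ))
    (hp : ∀ θ ∈ complexStrip r ρ, ∀ j : Fin r,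
      F (θ + Pi.single j ((2 * Real.pi : ℝ) : ℂ)) = F θ)
    {M : ℝ} (hM : ∀ θ ∈ complexStrip r ρ, ‖F θ‖ ≤ M) {f : C(UnitAddTorus (Fin r), ℂ)}
    (hf : ∀ x : Fin r → ℝ,
      f (fun j => (x j : UnitAddCircle)) = F fun j => ((2 * Real.pi * x j : ℝ) : ℂ))
    (n : Fin r → ℤ) (j : Fin r) :
    ‖UnitAddTorus.mFourierCoeff f n‖ ≤ M * Real.exp (-ρ * |(n j : ℝ)|) := by
  have hM0 : 0 ≤ M := (norm_nonneg _).trans (hM 0 fun j => by simpa using hρ)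
  have hmem : ∀ x : Fin r → ℝ, (fun j => ((2 * Real.pi * x j : ℝ) : ℂ)) ∈ complexStrip r ρ :=
    fun x j => by simpa using hρ
  have hexp : ∀ u : ℝ, ‖Complex.exp (-(Complex.I * u))‖ = 1 := fun u => by
    rw [Complex.norm_exp]; simp
  set g : (Fin r → ℝ) → ℂ := fun x =>
    Complex.exp (-(Complex.I * (∑ i, n i * (2 * Real.pi * x i) : ℝ))) *
      F (fun j => ((2 * Real.pi * x j : ℝ) : ℂ)) with hg
  have hgc : Continuous g := by
    refine Continuous.mul (by fun_prop) ?_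
    exact hF.continuousOn.comp_continuous (by fun_prop) hmem
  have hgn : ∀ x, ‖g x‖ ≤ M := fun x => by
    simp only [hg]
    rw [norm_mul, hexp, one_mul]
    exact hM _ (hmem x)
  have hcoef : ∀ a : Fin r → ℝ, UnitAddTorus.mFourierCoeff f n =
      ∫ x in {x : Fin r → ℝ | ∀ i, x i ∈ Set.Ioc (a i) (a i + 1)}, g x := fun a => by
    rw [UnitAddTorus.mFourierCoeff_eq_integral f n a]
    congr 1
    funext x
    rw [hf, smul_eq_mul]
    congr 1
    simp only [UnitAddTorus.mFourier, ContinuousMap.coe_mk, Pi.neg_apply, fourier_coe_apply,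
      ← Complex.exp_sum]
    congr 1
    rw [Complex.ofReal_sum, Finset.mul_sum, ← Finset.sum_neg_distrib]
    refine Finset.sum_congr rfl fun i _ => ?_
    push_cast; ring
  set D : Set (Fin r → ℝ) := {x | ∀ i, x i ∈ Set.Ioc (0 : ℝ) (0 + 1)} with hD
  have hDpi : D = Set.pi Set.univ fun _ => Set.Ioc (0 : ℝ) 1 := by
    ext x; simp [hD]
  have hDm : MeasurableSet D := by
    rw [hDpi]; exact MeasurableSet.univ_pi fun _ => measurableSet_Ioc
  have hDv : volume D = 1 := by
    rw [hDpi, Real.volume_pi_Ioc]; simp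
  have hfin : IsFiniteMeasure (volume.restrict D) := ⟨by simp [hDv]⟩
  have hshift : ∀ σ : ℝ, UnitAddTorus.mFourierCoeff f n =
      ∫ x in D, g (x + Pi.single j σ) := fun σ => by
    rw [hcoef (Pi.single j σ), ← (measurePreserving_add_right volume (Pi.single j σ :
      Fin r → ℝ)).setIntegral_preimage_emb (MeasurableEquiv.addRight _).measurableEmbedding]
    congr 2
    ext x
    simp only [Set.mem_preimage, Set.mem_ofPred_eq, hD, Pi.add_apply, Set.mem_Ioc, zero_add]
    refine forall_congr' fun i => ?_
    constructor <;> rintro ⟨h1, h2⟩ <;> constructor <;> linarith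
  have havg : UnitAddTorus.mFourierCoeff f n =
      ∫ x in D, ∫ σ in Set.Ioc (0 : ℝ) 1, g (x + Pi.single j σ) := by
    rw [integral_integral_swap]
    · simp only [← hshift]
      simp
    · refine Integrable.of_bound (Continuous.aestronglyMeasurable ?_) M
        (Eventually.of_forall fun p => hgn _)
      have : Continuous fun p : (Fin r → ℝ) × ℝ => p.1 + (Pi.single j p.2 : Fin r → ℝ) := by
        refine continuous_fst.add ?_
        exact (continuous_single j).comp continuous_snd
      exact hgc.comp this
  have hinner : ∀ x : Fin r → ℝ, ‖∫ σ in Set.Ioc (0 : ℝ) 1, g (x + Pi.single j σ)‖ ≤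
      M * Real.exp (-ρ * |(n j : ℝ)|) := by
    intro x
    set e : ℂ := Complex.exp (-(Complex.I * (∑ i, n i * (2 * Real.pi * x i) : ℝ))) with he
    have hen : ‖e‖ = 1 := hexp _
    set L : ℂ → Fin r → ℂ := fun z => (fun i => ((2 * Real.pi * x i : ℝ) : ℂ)) + Pi.single j z
      with hL
    have hLmem : ∀ z : ℂ, |z.im| ≤ ρ → L z ∈ complexStrip r ρ := fun z hz i => by
      by_cases h : i = j
      · subst h; simpa [hL] using hz
      · simpa [hL, h] using hρ
    set H : ℂ → ℂ := fun z => F (L z) * Complex.exp (-(Complex.I * (n j * z))) with hH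
    have hLd : Differentiable ℂ L := by
      refine (differentiable_const _).add ?_
      exact (ContinuousLinearMap.single ℂ (fun _ : Fin r => ℂ) j).differentiable
    have hHd : ∀ z : ℂ, |z.im| ≤ ρ → DifferentiableAt ℂ H z := fun z hz =>
      (DifferentiableAt.comp z (hF _ (hLmem z hz)).differentiableAt (hLd z)).mul (by fun_prop)
    have hHp : ∀ z : ℂ, |z.im| ≤ ρ → H (z + (2 * Real.pi : ℝ)) = H z := fun z hz => by
      have h1 : L (z + (2 * Real.pi : ℝ)) = L z + Pi.single j ((2 * Real.pi : ℝ) : ℂ) := by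
        simp only [hL]; rw [Pi.single_add, add_assoc]
      have h2 : Complex.exp (-(Complex.I * (n j * (z + (2 * Real.pi : ℝ))))) =
          Complex.exp (-(Complex.I * (n j * z))) := by
        rw [Complex.exp_eq_exp_iff_exists_int]
        exact ⟨-n j, by push_cast; ring⟩
      simp only [hH]
      rw [h1, h2, hp _ (hLmem z hz)]
    have hgH : ∀ σ : ℝ, g (x + Pi.single j σ) = e * H ((2 * Real.pi * σ : ℝ) : ℂ) := fun σ => by
      have h1 : (fun i => ((2 * Real.pi * (x + Pi.single j σ : Fin r → ℝ) i : ℝ) : ℂ)) =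
          L ((2 * Real.pi * σ : ℝ) : ℂ) := by
        funext i
        by_cases h : i = j
        · subst h; simp [hL]; ring
        · simp [hL, h]
      have h2 : ∑ i, (n i : ℝ) * (2 * Real.pi * (x + Pi.single j σ : Fin r → ℝ) i) =
          ∑ i, (n i : ℝ) * (2 * Real.pi * x i) + n j * (2 * Real.pi * σ) := by
        have h3 : ∑ i, (n i : ℝ) * (2 * Real.pi * (Pi.single j σ : Fin r → ℝ) i) =
            n j * (2 * Real.pi * σ) := by
          rw [Finset.sum_eq_single j]
          · simp
          · intro i _ hi; simp [hi]
          · simp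
        rw [← h3, ← Finset.sum_add_distrib]
        refine Finset.sum_congr rfl fun i _ => ?_
        rw [Pi.add_apply]; ring
      simp only [hg, hH]
      rw [h1, h2, he, Complex.ofReal_add, mul_add, neg_add, Complex.exp_add]; push_cast; ring
    -- the contour is shifted towards the side where `e^{-i n_j z}` decays
    obtain ⟨y, hy, hyn⟩ : ∃ y : ℝ, |y| ≤ ρ ∧ n j * y = -ρ * |(n j : ℝ)| := by
      rcases le_total 0 (n j : ℝ) with h | h
      · exact ⟨-ρ, by rw [abs_neg, abs_of_nonneg hρ], by rw [abs_of_nonneg h]; ring⟩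
      · exact ⟨ρ, by rw [abs_of_nonneg hρ], by rw [abs_of_nonpos h]; ring⟩
    have hHn : ∀ u : ℝ, ‖H (u + y * Complex.I)‖ ≤ M * Real.exp (-ρ * |(n j : ℝ)|) := fun u => by
      have h1 : |(u + y * Complex.I : ℂ).im| ≤ ρ := by simpa using hy
      simp only [hH]
      rw [norm_mul, Complex.norm_exp]
      have h2 : (-(Complex.I * (n j * (u + y * Complex.I)))).re = -ρ * |(n j : ℝ)| := by
        rw [← hyn]; simp
      rw [h2]
      exact mul_le_mul_of_nonneg_right (hM _ (hLmem _ h1)) (Real.exp_nonneg _)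
    have h2π : (0 : ℝ) < 2 * Real.pi := Real.two_pi_pos
    rw [← intervalIntegral.integral_of_le zero_le_one]
    simp only [hgH]
    rw [intervalIntegral.integral_const_mul, norm_mul, hen, one_mul]
    have hsub := intervalIntegral.integral_comp_mul_add (a := 0) (b := 1)
      (fun u : ℝ => H (u : ℂ)) h2π.ne' 0
    simp only [add_zero, mul_zero, mul_one] at hsub
    rw [hsub, integral_shift hHd hHp hy, norm_smul]
    have hb := intervalIntegral.norm_integral_le_of_norm_le_const (a := 0) (b := 2 * Real.pi)
      (f := fun u : ℝ => H (u + y * Complex.I)) fun u _ => hHn u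
    rw [sub_zero, abs_of_pos h2π] at hb
    rw [norm_inv, Real.norm_of_nonneg h2π.le, inv_mul_le_iff₀ h2π]
    linarith
  rw [havg]
  have := norm_setIntegral_le_of_norm_le_const (μ := volume) (s := D) (by rw [hDv]; simp)
    (fun x _ => hinner x)
  simpa [measureReal_def, hDv] using this

lemma summable_exp_neg_order {σ : ℝ} (hσ : 0 < σ) (r : ℕ) :
    Summable fun k : Fin r → ℤ => Real.exp (-σ * order k) := by
  have h1 : Summable fun n : ℤ => Real.exp (-σ * |(n : ℝ)|) := by
    have h := (Real.summable_exp_nat_mul_iff (a := -σ)).2 (by linarith)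
    refine Summable.of_nat_of_neg ?_ ?_
    · refine h.congr fun n => ?_
      simp [mul_comm]
    · refine h.congr fun n => ?_
      simp [mul_comm]
  refine (summable_prod_pi (fun n => Real.exp_nonneg _) h1 r).congr fun k => ?_
  rw [← Real.exp_sum, ← Finset.mul_sum]; rfl

/-- Analytic quasi-periodic functions have exponentially weighted absolutely summable
expansions. -/
lemma exists_qpBound {ω : Fin r → ℝ} (hρ : 0 < ρ) {a : ℝ → ℝ}
    (ha : IsAnalyticQuasiPeriodic ω ρ a) :
    ∃ s > 0, ∃ M, QPBound ω Set.univ s M (fun _ t => (a t : ℂ)) := by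
  obtain ⟨F, hF, hp, haF⟩ := ha
  rcases Nat.eq_zero_or_pos r with rfl | hr
  · refine ⟨1, one_pos, _, (QPBound.const (a 0 : ℂ)).congr fun _ _ t => ?_⟩
    rw [haF, haF]
    congr 1
    exact Subsingleton.elim _ _
  obtain ⟨M, hM⟩ := exists_bound_of_periodic hF hp
  obtain ⟨f, hf⟩ := exists_torus_function hρ.le hF hp
  have hr' : (0 : ℝ) < r := by exact_mod_cast hr
  have hM0 : 0 ≤ M := (norm_nonneg _).trans (hM 0 fun j => by simpa using hρ.le)
  set c := UnitAddTorus.mFourierCoeff f with hc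
  have hdecay : ∀ k : Fin r → ℤ, ‖c k‖ ≤ M * Real.exp (-(ρ / r) * order k) := fun k => by
    have : Nonempty (Fin r) := ⟨⟨0, hr⟩⟩
    obtain ⟨j, hj⟩ := Finite.exists_max fun j => |(k j : ℝ)|
    refine (norm_mFourierCoeff_le hρ.le hF hp hM hf k j).trans ?_
    have h1 : order k ≤ r * |(k j : ℝ)| := by
      have := Finset.sum_le_card_nsmul Finset.univ (fun j => |(k j : ℝ)|) _ fun i _ => hj i
      simpa [order] using this
    have h2 : ρ / r * order k ≤ ρ * |(k j : ℝ)| := by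
      calc ρ / r * order k ≤ ρ / r * (r * |(k j : ℝ)|) := by gcongr
        _ = _ := by field_simp
    exact mul_le_mul_of_nonneg_left (Real.exp_le_exp.2 (by linarith)) hM0
  set s : ℝ := ρ / r / 2 with hs
  have hs0 : 0 < s := by positivity
  have hcmp : ∀ k, ‖c k‖ * Real.exp (s * order k) ≤ M * Real.exp (-s * order k) := fun k => by
    calc _ ≤ M * Real.exp (-(ρ / r) * order k) * Real.exp (s * order k) := by
          gcongr; exact hdecay k
      _ = _ := by rw [mul_assoc, ← Real.exp_add]; congr 2; rw [hs]; ring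
  have hsum : Summable fun k => ‖c k‖ * Real.exp (s * order k) :=
    Summable.of_nonneg_of_le (fun k => by positivity) hcmp
      ((summable_exp_neg_order hs0 r).mul_left M)
  have hcs : Summable c := Summable.of_norm (Summable.of_nonneg_of_le (fun k => norm_nonneg _)
    (fun k => QPBound.le_weight hs0.le (norm_nonneg _) k) hsum)
  refine ⟨s, hs0, _, Fin r → ℤ, fun k => k, fun k _ => c k, fun k => ‖c k‖,
    fun k => LipBound.const _, hsum, le_rfl, fun _ _ t => ?_⟩
  have h := UnitAddTorus.hasSum_mFourier_series_apply_of_summable hcs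
    (fun j => ((ω j * t / (2 * Real.pi) : ℝ) : UnitAddCircle))
  have hpi : (Real.pi : ℂ) ≠ 0 := by exact_mod_cast Real.pi_ne_zero
  have hval : f (fun j => ((ω j * t / (2 * Real.pi) : ℝ) : UnitAddCircle)) = a t := by
    rw [hf, haF]
    congr 1
    funext j
    rw [mul_div_cancel₀ _ Real.two_pi_pos.ne']
  have hwave : ∀ k : Fin r → ℤ, UnitAddTorus.mFourier k
      (fun j => ((ω j * t / (2 * Real.pi) : ℝ) : UnitAddCircle)) = wave ω k t := fun k => by
    simp only [UnitAddTorus.mFourier, ContinuousMap.coe_mk, fourier_coe_apply, ← Complex.exp_sum]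
    rw [wave, freq]
    congr 1
    push_cast
    rw [Finset.sum_mul, Finset.sum_mul]
    refine Finset.sum_congr rfl fun j _ => ?_
    field_simp
  rw [hval] at h
  simpa only [hwave, smul_eq_mul] using h

end Fourier

/-! ### Hill's equation in averaged coordinates -/

/-- With `X = x` and `W = ẋ/Λ + Λ B x`, where `B' = b`, Hill's equation `ẍ + Λ²(1 + b)x = 0` becomes
a rotation with angular velocity `Λ` up to terms of order `Λ²`, and bounds on its growth give
Lyapunov stability. -/
lemma isLyapunovStable_of_growthBound {q B b : ℝ → ℝ} {Λ β C : ℝ} (hΛ : 0 < Λ)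
    (hB : ∀ t, HasDerivAt B (b t) t) (hβ : ∀ t, |B t| ≤ β) (hC : 0 ≤ C)
    (hq : ∀ t, q t = Λ ^ 2 * (1 + b t))
    (hg : GrowthBound C 0 (fun t => -Λ - Λ ^ 3 * B t ^ 2 / 2)
      (fun t => -(Λ ^ 2 * B t : ℝ) - Complex.I * (Λ ^ 3 * B t ^ 2 / 2 : ℝ))) :
    IsLyapunovStable (hillField q) 0 := by
  refine ⟨fun t => by simp [hillField], fun t₀ η hη => ?_⟩
  have hβ0 : 0 ≤ β := (abs_nonneg _).trans (hβ 0)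
  set c₁ : ℝ := 1 + 1 / Λ + Λ * β with hc₁
  set c₂ : ℝ := 1 + Λ * (1 + Λ * β) with hc₂
  have hc₁0 : 0 < c₁ := by positivity
  have hc₂0 : 0 < c₂ := by positivity
  refine ⟨η / (c₂ * C * c₁ + 1), by positivity, fun T z hz h0 t ht => ?_⟩
  rw [sub_zero] at h0 ⊢
  set u : ℝ → ℂ := fun τ =>
    (((z τ).1 : ℝ) : ℂ) + Complex.I * (((z τ).2 / Λ + Λ * B τ * (z τ).1 : ℝ) : ℂ) with hu
  have hre : ∀ τ, (u τ).re = (z τ).1 := fun τ => by simp [hu]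
  have him : ∀ τ, (u τ).im = (z τ).2 / Λ + Λ * B τ * (z τ).1 := fun τ => by simp [hu]
  have hle : ∀ τ, ‖u τ‖ ≤ c₁ * ‖z τ‖ := fun τ => by
    have h1 : |(z τ).1| ≤ ‖z τ‖ := norm_fst_le (z τ)
    have h2 : |(z τ).2| ≤ ‖z τ‖ := norm_snd_le (z τ)
    have h3 := Complex.norm_le_abs_re_add_abs_im (u τ)
    rw [hre, him] at h3
    have h4 : |(z τ).2 / Λ + Λ * B τ * (z τ).1| ≤ 1 / Λ * ‖z τ‖ + Λ * β * ‖z τ‖ := by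
      refine (abs_add_le _ _).trans (add_le_add ?_ ?_)
      · rw [abs_div, abs_of_pos hΛ, div_eq_inv_mul, ← one_div]
        gcongr
      · rw [abs_mul, abs_mul, abs_of_pos hΛ]
        gcongr
        exact hβ τ
    rw [hc₁]; linarith
  have hge : ∀ τ, ‖z τ‖ ≤ c₂ * ‖u τ‖ := fun τ => by
    have h1 := Complex.abs_re_le_norm (u τ)
    have h2 := Complex.abs_im_le_norm (u τ)
    have hn := norm_nonneg (u τ)
    have e : (z τ).2 = Λ * ((u τ).im - Λ * B τ * (u τ).re) := by
      rw [hre, him]; field_simp; ring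
    refine max_le ?_ ?_
    · rw [← hre, Real.norm_eq_abs]
      refine h1.trans (le_mul_of_one_le_left hn ?_)
      rw [hc₂]; linarith [show 0 ≤ Λ * (1 + Λ * β) by positivity]
    · rw [e, Real.norm_eq_abs, abs_mul, abs_of_pos hΛ]
      have h3 : |(u τ).im - Λ * B τ * (u τ).re| ≤ ‖u τ‖ + Λ * β * ‖u τ‖ := by
        refine (abs_sub _ _).trans (add_le_add h2 ?_)
        rw [abs_mul, abs_mul, abs_of_pos hΛ]
        gcongr
        exact hβ τ
      have h4 := mul_le_mul_of_nonneg_left h3 hΛ.le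
      rw [hc₂]; linarith
  have hut := hg t₀ T u (fun τ hτ => ?_) t ht
  · rw [zero_mul, Real.exp_zero, mul_one] at hut
    rw [lt_div_iff₀ (by positivity)] at h0
    calc ‖z t‖ ≤ c₂ * ‖u t‖ := hge t
      _ ≤ c₂ * (C * (c₁ * ‖z t₀‖)) := by
        gcongr
        exact hut.trans (mul_le_mul_of_nonneg_left (hle t₀) hC)
      _ ≤ ‖z t₀‖ * (c₂ * C * c₁ + 1) := by linarith [norm_nonneg (z t₀)]
      _ < η := h0
  · have hd := hz τ hτ
    have hx : HasDerivWithinAt (fun τ => (z τ).1) (z τ).2 (Set.Icc t₀ T) τ :=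
      (ContinuousLinearMap.fst ℝ ℝ ℝ).hasFDerivAt.comp_hasDerivWithinAt τ hd
    have hy : HasDerivWithinAt (fun τ => (z τ).2) (-(q τ * (z τ).1)) (Set.Icc t₀ T) τ :=
      (ContinuousLinearMap.snd ℝ ℝ ℝ).hasFDerivAt.comp_hasDerivWithinAt τ hd
    have hW := (hy.div_const Λ).add (((hB τ).hasDerivWithinAt.const_mul Λ).mul hx)
    have hU := hx.ofReal_comp.add (hW.ofReal_comp.const_mul Complex.I)
    refine hU.congr_deriv ?_
    have hΛC : (Λ : ℂ) ≠ 0 := by exact_mod_cast hΛ.ne'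
    simp only [hu, hq, map_add, map_mul, Complex.conj_ofReal, Complex.conj_I]
    push_cast
    field_simp
    ring_nf
    simp only [Complex.I_sq]
    ring

/-! ### Conclusion -/

/-- Freezing the parameter. -/
lemma QPBound.eval {r : ℕ} {ω : Fin r → ℝ} {E : Set ℝ} {s M : ℝ} {f : ℝ → ℝ → ℂ}
    (h : QPBound ω E s M f) {x₀ : ℝ} (hx₀ : x₀ ∈ E) (E' : Set ℝ) :
    QPBound ω E' s M (fun _ t => f x₀ t) := by
  obtain ⟨ι, k, c, m, hc, hsum, hle, hf⟩ := h
  exact ⟨ι, k, fun i _ => c i x₀, m,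
    fun i => (LipBound.const (c i x₀)).mono le_rfl ((hc i).2.1 x₀ hx₀), hsum, hle,
    fun _ _ t => hf x₀ hx₀ t⟩

/-- The Diophantine condition with a natural exponent, large enough for the resonance widths to be
summable. -/
lemma exists_pow_of_isDiophantine {r : ℕ} {ω : Fin r → ℝ} {α τ : ℝ} (hα : 0 < α)
    (hω : IsDiophantine ω α τ) :
    ∃ (T : ℕ) (A : ℝ), 2 * r ≤ T ∧ 0 ≤ A ∧
      ∀ k : Fin r → ℤ, k ≠ 0 → 1 ≤ A * (1 + order k) ^ T * |freq ω k| := by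
  refine ⟨max (2 * r) ⌈|τ|⌉₊, 1 / α, le_max_left _ _, by positivity, fun k hk => ?_⟩
  have h1 : 1 ≤ order k := by
    obtain ⟨j, hj⟩ := Function.ne_iff.1 hk
    have h2 : |(k j : ℝ)| ≤ order k :=
      Finset.single_le_sum (f := fun j => |(k j : ℝ)|) (fun _ _ => abs_nonneg _)
        (Finset.mem_univ j)
    have h3 : (1 : ℝ) ≤ |(k j : ℝ)| := by exact_mod_cast Int.one_le_abs hj
    exact h3.trans h2
  have h4 : α / order k ^ τ ≤ |freq ω k| := hω k hk
  have h5 : order k ^ τ ≤ (1 + order k) ^ max (2 * r) ⌈|τ|⌉₊ := by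
    rw [← Real.rpow_natCast]
    have h6 : τ ≤ (max (2 * r) ⌈|τ|⌉₊ : ℕ) :=
      (le_abs_self τ).trans ((Nat.le_ceil _).trans (by exact_mod_cast le_max_right _ _))
    exact (Real.rpow_le_rpow_of_exponent_le h1 h6).trans
      (Real.rpow_le_rpow (by linarith) (by linarith) (Nat.cast_nonneg _))
  have h7 : 0 < order k ^ τ := Real.rpow_pos_of_pos (by linarith) _
  rw [div_le_iff₀ h7] at h4
  rw [mul_assoc, one_div, ← div_eq_inv_mul, one_le_div hα, mul_comm]
  exact h4.trans (mul_le_mul_of_nonneg_left h5 (abs_nonneg _))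

/-- If `a - m'` has a bounded primitive, then `m'` is the average of `a`. -/
lemma average_eq_of_hasDerivAt {a g : ℝ → ℝ} {m m' M : ℝ} (h : HasAverage a m)
    (ha : Continuous a) (hg : ∀ t, HasDerivAt g (a t - m') t) (hM : ∀ t, |g t| ≤ M) : m = m' := by
  refine tendsto_nhds_unique h ?_
  have h1 : ∀ T : ℝ, 0 < T →
      (1 / (2 * T)) * ∫ t in (-T)..T, a t = m' + (1 / (2 * T)) * (g T - g (-T)) := by
    intro T hT
    have h2 := intervalIntegral.integral_eq_sub_of_hasDerivAt (a := -T) (b := T)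
      (fun t _ => hg t) ((ha.sub continuous_const).intervalIntegrable _ _)
    rw [intervalIntegral.integral_sub (ha.intervalIntegrable _ _)
      (continuous_const.intervalIntegrable _ _), intervalIntegral.integral_const] at h2
    rw [sub_eq_iff_eq_add.1 h2, smul_eq_mul]
    field_simp; ring
  have h3 : Tendsto (fun T : ℝ => (1 / (2 * T)) * (g T - g (-T))) atTop (𝓝 0) := by
    refine squeeze_zero_norm' (a := fun T : ℝ => M * T⁻¹) ?_ ?_
    · filter_upwards [eventually_gt_atTop 0] with T hT
      have h4 : |g T - g (-T)| ≤ 2 * M := by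
        refine (abs_sub _ _).trans ?_
        linarith [hM T, hM (-T)]
      rw [Real.norm_eq_abs, abs_mul, abs_of_pos (by positivity)]
      calc 1 / (2 * T) * |g T - g (-T)| ≤ 1 / (2 * T) * (2 * M) := by gcongr
        _ = M * T⁻¹ := by field_simp
    · simpa using tendsto_inv_atTop_zero.const_mul M
  have h5 : Tendsto (fun T : ℝ => m' + (1 / (2 * T)) * (g T - g (-T))) atTop (𝓝 (m' + 0)) :=
    tendsto_const_nhds.add h3
  rw [add_zero] at h5
  refine h5.congr' ?_
  filter_upwards [eventually_gt_atTop 0] with T hT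
  exact (h1 T hT).symm

/-- The relative measure of the bad parameters in the dyadic interval `[e, 2e]` tends to zero. -/
lemma exists_small_bad_set {r : ℕ} {ω : Fin r → ℝ} {ρ : ℝ} (hρ : 0 < ρ) {a : ℝ → ℝ}
    (ha : IsAnalyticQuasiPeriodic ω ρ a) {abar : ℝ} (havg : HasAverage a abar) (habar : 0 < abar)
    {α τ : ℝ} (hα : 0 < α) (hω : IsDiophantine ω α τ) {κ : ℝ} (hκ : 0 < κ) :
    ∃ e₀ > 0, ∀ e, 0 < e → e < e₀ →
      volume {ε ∈ Set.Icc e (2 * e) | ¬IsLyapunovStable (hillField fun t => ε * a t) 0} ≤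
        ENNReal.ofReal (κ * e) := by
  obtain ⟨T, A, hT, hA, hpow⟩ := exists_pow_of_isDiophantine hα hω
  have hfreq : ∀ k ≠ 0, freq ω k ≠ 0 := fun k hk h0 => by
    have := hpow k hk
    rw [h0, abs_zero, mul_zero] at this
    linarith
  obtain ⟨s, hs, M₀, hqa⟩ := exists_qpBound hρ ha
  -- the loss of width in the two integrations that precede the iteration
  have hloss : ∀ s > 0, ∃ s' > 0, s' ≤ s ∧ ∃ K, 0 ≤ K ∧ ∀ k ≠ 0,
      Real.exp (s' * order k) ≤ K * |freq ω k| * Real.exp (s * order k) := by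
    intro s hs
    obtain ⟨K₀, B, hK₀, hB, h⟩ := exists_geometric_loss hA hpow hs
    obtain ⟨s₁, h1, h2, -, h4⟩ := h 0
    have h2' : s₁ ≤ s := by simpa using h2
    refine ⟨_, by positivity, h1.trans h2', K₀, hK₀.le, fun k hk => ?_⟩
    refine (h4 k hk).trans ?_
    rw [pow_zero, mul_one]
    gcongr
    exact order_nonneg k
  obtain ⟨s₁, hs₁, hs₁s, K₁, hK₁0, hK₁⟩ := hloss s hs
  obtain ⟨s₂, hs₂, hs₂s, K₂, hK₂0, hK₂⟩ := hloss s₁ hs₁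
  obtain ⟨mc, G, -, hG, hGd⟩ := exists_primitive hqa hs.le hs₁.le hK₁0 hK₁
  have hGre : ∀ t, HasDerivAt (fun t => (G 0 t).re) (a t - (mc 0).re) t := fun t => by
    have h1 := Complex.reCLM.hasFDerivAt.comp_hasDerivAt t (hGd 0 trivial t)
    refine h1.congr_deriv ?_
    simp
  have hac : Continuous a := by
    have h1 : Continuous fun t => (a t : ℂ) := by
      obtain ⟨F, hF, -, haF⟩ := ha
      simp only [haF]
      refine hF.continuousOn.comp_continuous (by fun_prop) fun t j => by simpa using hρ.le
    exact Complex.continuous_re.comp h1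
  have hmean : abar = (mc 0).re := average_eq_of_hasDerivAt havg hac hGre fun t =>
    (Complex.abs_re_le_norm _).trans (hG.norm_le hs₁.le trivial t)
  set B : ℝ → ℝ := fun t => (G 0 t).re / abar with hB
  have hBd : ∀ t, HasDerivAt B (a t / abar - 1) t := fun t => by
    refine ((hGre t).div_const abar).congr_deriv ?_
    rw [← hmean]; field_simp
  obtain ⟨M, hBq⟩ : ∃ M, QPBound ω (Set.Icc 1 2) s₁ M (fun _ t => (B t : ℂ)) := by
    refine ⟨_, (((hG.eval (Set.mem_univ 0) (Set.Icc 1 2)).ofReal_re hs₁.le).smul hs₁.le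
      (abar : ℂ)⁻¹).congr fun x _ t => ?_⟩
    simp only [hB]; push_cast; ring
  have hM0 := hBq.nonneg
  have hBn : ∀ t, |B t| ≤ M := fun t => by
    have := hBq.norm_le hs₁.le (x := 1) (by norm_num) t
    rwa [Complex.norm_real] at this
  have hsqrt : LipBound (Set.Icc 1 2) 2 (fun x => (√x : ℂ)) := by
    refine (LipBound.of_le (S := 3 / 2) (l := 1 / 2) (by norm_num) (by norm_num)
      (fun x hx => ?_) fun x hx y hy => ?_).mono le_rfl (by norm_num)
    · rw [Complex.norm_real, Real.norm_of_nonneg (Real.sqrt_nonneg _)]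
      exact Real.sqrt_le_iff.2 ⟨by norm_num, by linarith [hx.2]⟩
    · rw [← Complex.ofReal_sub, Complex.norm_real, Real.norm_eq_abs]
      linarith [(abs_sqrt_sub_sqrt_bounds hx hy).2]
  have hid : LipBound (Set.Icc 1 2) 3 (fun x => (x : ℂ)) := by
    refine (LipBound.of_le (S := 2) (l := 1) (by norm_num) (by norm_num)
      (fun x hx => ?_) fun x hx y hy => ?_).mono le_rfl (by norm_num)
    · rw [Complex.norm_real, Real.norm_of_nonneg (by linarith [hx.1])]; exact hx.2
    · rw [← Complex.ofReal_sub, Complex.norm_real, Real.norm_eq_abs, one_mul]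
  obtain ⟨δ, hδ, hiter⟩ := exists_iteration hA hpow hs₂
  -- smallness conditions on `Λ = √(abar * e)`
  have hsmall : ∀ᶠ Λ : ℝ in 𝓝[>] 0, Λ ≤ 1 ∧ 3 * Λ ^ 2 * M ^ 2 ≤ 1 / 10 ∧
      (3 * Λ * M + 3 * Λ ^ 2 * M ^ 2) * Real.exp (2 * (K₂ * (3 * Λ ^ 2 * M ^ 2))) ≤ δ ∧
      20 * smallDivisorSum ω T Λ ≤ κ := by
    have h1 : ∀ᶠ Λ : ℝ in 𝓝[>] 0, Λ ≤ 1 := nhdsWithin_le_nhds (ge_mem_nhds one_pos)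
    have h2 : Tendsto (fun Λ : ℝ => 3 * Λ ^ 2 * M ^ 2) (𝓝[>] 0) (𝓝 (3 * 0 ^ 2 * M ^ 2)) :=
      tendsto_nhdsWithin_of_tendsto_nhds (Continuous.tendsto (by fun_prop) 0)
    have h3 : Tendsto (fun Λ : ℝ => (3 * Λ * M + 3 * Λ ^ 2 * M ^ 2) *
        Real.exp (2 * (K₂ * (3 * Λ ^ 2 * M ^ 2)))) (𝓝[>] 0) (𝓝 ((3 * 0 * M + 3 * 0 ^ 2 * M ^ 2) *
        Real.exp (2 * (K₂ * (3 * 0 ^ 2 * M ^ 2))))) :=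
      tendsto_nhdsWithin_of_tendsto_nhds (Continuous.tendsto (by fun_prop) 0)
    have h4 := (tendsto_smallDivisorSum (ω := ω) hT hfreq).const_mul 20
    filter_upwards [h1, h2.eventually (ge_mem_nhds (by norm_num : 3 * 0 ^ 2 * M ^ 2 < 1 / 10)),
      h3.eventually (ge_mem_nhds (by simpa using hδ)),
      h4.eventually (ge_mem_nhds (by simpa using hκ))] with Λ a1 a2 a3 a4
    exact ⟨a1, a2, a3, a4⟩
  obtain ⟨Λ₁, hΛ₁, hΛ₁'⟩ := mem_nhdsGT_iff_exists_Ioo_subset.1 hsmall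
  have hΛ₁0 : (0 : ℝ) < Λ₁ := hΛ₁
  refine ⟨Λ₁ ^ 2 / abar, by positivity, fun e he hee => ?_⟩
  set Λ : ℝ := √(abar * e) with hΛdef
  have hΛ0 : 0 < Λ := Real.sqrt_pos.2 (by positivity)
  have hΛsq : Λ ^ 2 = abar * e := Real.sq_sqrt (by positivity)
  have hΛlt : Λ < Λ₁ := by
    rw [lt_div_iff₀ habar] at hee
    exact (Real.sqrt_lt' hΛ₁0).2 (by linarith)
  obtain ⟨hΛ1, hsm1, hsm2, hsm3⟩ := hΛ₁' ⟨hΛ0, hΛlt⟩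
  have hxs := QPBound.of_lipBound (ω := ω) (s := s₁) (hid.mul hsqrt)
  have hcub : QPBound ω (Set.Icc 1 2) s₁ (3 * Λ ^ 2 * M ^ 2)
      (fun x t => ((Λ ^ 2 * (x * √x) * B t ^ 2 / 2 : ℝ) : ℂ)) := by
    refine (((hxs.mul (hBq.pow hs₁.le 2) hs₁.le).smul hs₁.le (Λ ^ 2 / 2 : ℂ)).mono le_rfl le_rfl
      (le_of_eq ?_)).congr fun x _ t => ?_
    · rw [norm_div, norm_pow, Complex.norm_real, Real.norm_of_nonneg hΛ0.le]
      norm_num; ring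
    · push_cast; ring
  have hlin : QPBound ω (Set.Icc 1 2) s₁ (3 * Λ * M) (fun x t => ((Λ * x * B t : ℝ) : ℂ)) := by
    refine ((((QPBound.of_lipBound (ω := ω) (s := s₁) hid).mul hBq hs₁.le).smul hs₁.le
      (Λ : ℂ)).mono le_rfl le_rfl (le_of_eq ?_)).congr fun x _ t => ?_
    · rw [Complex.norm_real, Real.norm_of_nonneg hΛ0.le]; ring
    · push_cast; ring
  -- the averaged system in units of `Λ`; its own angular velocity is `Λ √x`
  set P : ℝ → ℝ → ℝ := fun x t => -(Λ ^ 2 * (x * √x) * B t ^ 2 / 2) with hP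
  set Q : ℝ → ℝ → ℂ := fun x t =>
    -((Λ * x * B t : ℝ) : ℂ) - Complex.I * ((Λ ^ 2 * (x * √x) * B t ^ 2 / 2 : ℝ) : ℂ) with hQ
  have hPq : QPBound ω (Set.Icc 1 2) s₁ (3 * Λ ^ 2 * M ^ 2) (fun x t => (P x t : ℂ)) :=
    (hcub.neg hs₁.le).congr fun x _ t => by simp only [hP]; push_cast; ring
  have hQq : QPBound ω (Set.Icc 1 2) s₁ (3 * Λ * M + 3 * Λ ^ 2 * M ^ 2) Q := by
    refine (((hlin.neg hs₁.le).add (hcub.smul hs₁.le (-Complex.I)) hs₁.le).mono le_rfl le_rfl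
      (le_of_eq ?_)).congr fun x _ t => ?_
    · simp
    · simp only [hQ]; ring
  obtain ⟨m, Q', hm, hQ', htrans⟩ := exists_diagonal_average (ℓ := fun x => -√x) hPq hQq hs₂.le
    hs₂s hK₂0 hK₂ hΛ0 hΛ1
  obtain ⟨S, hS0, hSn, hSl, hSg⟩ := hiter Λ ⟨Set.Icc 1 2, fun x => -√x + m x, Q'⟩ hΛ0 hΛ1 le_rfl
    ((hm.congr fun x _ => by push_cast; ring).mono le_rfl hsm1) (hQ'.mono le_rfl le_rfl hsm2)
  have hvol := volume_diff_iInter_nonresonant_le hT hΛ0 hSn hSl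
  rw [hS0] at hvol
  have hsub : {ε ∈ Set.Icc e (2 * e) | ¬IsLyapunovStable (hillField fun t => ε * a t) 0} ⊆
      (fun ε => e⁻¹ * ε) ⁻¹' (Set.Icc 1 2 \ ⋂ n, (S n).params) := by
    rintro ε ⟨hε, hbad⟩
    have hx : e⁻¹ * ε ∈ Set.Icc (1 : ℝ) 2 := by
      rw [← div_eq_inv_mul]
      exact ⟨(one_le_div he).2 hε.1, (div_le_iff₀ he).2 hε.2⟩
    refine ⟨hx, fun hmem => hbad ?_⟩
    set x := e⁻¹ * ε with hxdef
    have hε' : ε = e * x := by rw [hxdef]; field_simp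
    have hx0 : 0 < x := zero_lt_one.trans_le hx.1
    have hsx : √x ^ 2 = x := Real.sq_sqrt hx0.le
    have hgrow := htrans x hx _ _ (hSg x hmem)
    refine isLyapunovStable_of_growthBound (Λ := Λ * √x) (B := B) (C := Real.exp 2)
      (mul_pos hΛ0 (Real.sqrt_pos.2 hx0)) hBd hBn (Real.exp_nonneg _) (fun t => ?_) ?_
    · rw [mul_pow, hΛsq, hsx, hε']; field_simp; ring
    · convert hgrow using 2 with t t
      · simp only [hP]
        linear_combination (-(Λ ^ 3 * √x * B t ^ 2 / 2)) * hsx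
      · have e2 : (Λ * √x) ^ 2 * B t = Λ * (Λ * x * B t) := by
          linear_combination (Λ ^ 2 * B t) * hsx
        have e3 : (Λ * √x) ^ 3 * B t ^ 2 / 2 = Λ * (Λ ^ 2 * (x * √x) * B t ^ 2 / 2) := by
          linear_combination (Λ ^ 3 * √x * B t ^ 2 / 2) * hsx
        simp only [hQ]
        rw [e2, e3]; push_cast; ring
  calc _ ≤ volume ((fun ε => e⁻¹ * ε) ⁻¹' (Set.Icc 1 2 \ ⋂ n, (S n).params)) := measure_mono hsub
    _ = ENNReal.ofReal e * volume (Set.Icc 1 2 \ ⋂ n, (S n).params) := by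
      rw [Real.volume_preimage_mul_left (inv_ne_zero he.ne'), inv_inv, abs_of_pos he]
    _ ≤ ENNReal.ofReal e * ENNReal.ofReal κ := by
      gcongr
      exact hvol.trans (ENNReal.ofReal_le_ofReal hsm3)
    _ = _ := by rw [← ENNReal.ofReal_mul he.le, mul_comm]

/-- A bound for the relative measure of the exceptional set in all small dyadic intervals implies
that its relative measure in `(0, ε₀)` tends to zero. -/
lemma forMostSmallPos_of_dyadic {P : ℝ → Prop}
    (h : ∀ κ > 0, ∃ e₀ > 0, ∀ e, 0 < e → e < e₀ →
      volume {ε ∈ Set.Icc e (2 * e) | ¬P ε} ≤ ENNReal.ofReal (κ * e)) : ForMostSmallPos P := by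
  rw [ForMostSmallPos, ENNReal.tendsto_nhds_zero]
  intro κ' hκ'
  obtain ⟨κ, hκ, hκκ⟩ : ∃ κ > 0, ENNReal.ofReal κ ≤ κ' := by
    rcases eq_or_ne κ' ⊤ with rfl | ht
    · exact ⟨1, one_pos, le_top⟩
    · exact ⟨κ'.toReal, ENNReal.toReal_pos hκ'.ne' ht, (ENNReal.ofReal_toReal ht).le⟩
  obtain ⟨e₀, he₀, hvol⟩ := h κ hκ
  filter_upwards [self_mem_nhdsWithin, nhdsWithin_le_nhds (gt_mem_nhds he₀)] with ε₀ hε₀ hlt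
  have hε₀' : (0 : ℝ) < ε₀ := hε₀
  refine le_trans ?_ hκκ
  have hsub : Set.Ioo 0 ε₀ \ {ε | P ε} ⊆
      ⋃ j : ℕ, {ε ∈ Set.Icc (ε₀ * (1 / 2) ^ (j + 1)) (2 * (ε₀ * (1 / 2) ^ (j + 1))) | ¬P ε} := by
    rintro ε ⟨hε, hP⟩
    obtain ⟨j, h1, h2⟩ := exists_nat_pow_near_of_lt_one (div_pos hε.1 hε₀')
      ((div_le_one hε₀').2 hε.2.le) (by norm_num : (0 : ℝ) < 1 / 2) (by norm_num)
    rw [lt_div_iff₀ hε₀'] at h1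
    rw [div_le_iff₀ hε₀'] at h2
    refine Set.mem_iUnion.2 ⟨j, ⟨by linarith, ?_⟩, hP⟩
    rw [pow_succ]; linarith
  have hgeo : HasSum (fun j : ℕ => κ * (ε₀ * (1 / 2 : ℝ) ^ (j + 1))) (κ * ε₀) := by
    have := hasSum_geometric_two.mul_left (κ * ε₀ / 2)
    rw [show κ * ε₀ / 2 * 2 = κ * ε₀ by ring] at this
    refine this.congr_fun fun j => ?_
    rw [pow_succ]; ring
  have hle : volume (Set.Ioo 0 ε₀ \ {ε | P ε}) ≤ ENNReal.ofReal (κ * ε₀) := by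
    calc _ ≤ ∑' j : ℕ, ENNReal.ofReal (κ * (ε₀ * (1 / 2 : ℝ) ^ (j + 1))) := by
          refine (measure_mono hsub).trans ((measure_iUnion_le _).trans
            (ENNReal.tsum_le_tsum fun j => hvol _ (by positivity) ?_))
          have : ((1 : ℝ) / 2) ^ (j + 1) ≤ 1 := pow_le_one₀ (by norm_num) (by norm_num)
          nlinarith
      _ = _ := by
        rw [← ENNReal.ofReal_tsum_of_nonneg (fun j => by positivity) hgeo.summable, hgeo.tsum_eq]
  rw [ENNReal.ofReal_mul hκ.le] at hle
  exact ENNReal.div_le_of_le_mul hle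

end QuasiPeriodic

theorem theorem4p2 {r : ℕ} (ω : Fin r → ℝ) (ρ : ℝ) (hρ : 0 < ρ) (a : ℝ → ℝ)
    (ha : IsAnalyticQuasiPeriodic ω ρ a)
    (abar : ℝ) (havg : HasAverage a abar) (habar : 0 < abar)
    (α τ : ℝ) (hα : 0 < α) (hτ : (r : ℝ) - 1 < τ) (hω : IsDiophantine ω α τ) :
    ForMostSmallPos (fun ε => IsLyapunovStable (hillField (fun t => ε * a t)) 0) :=
  QuasiPeriodic.forMostSmallPos_of_dyadic fun _ hκ =>
    QuasiPeriodic.exists_small_bad_set hρ ha havg habar hα hω hκ
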